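/- All Banach algebras are complex and need not have an identity. Let $\Omega$ be a locally compact Hausdorff space and let $\mathcal U=\{\Omega,(A_t)_{t\in\Omega},\Theta\}$ be a continuous field of Banach algebras, that is, $\Theta$ is a subalgebra of $\prod_{t\in\Omega}A_t$ such that (a) $\{x(t):x\in\Theta\}$ is dense in $A_t$ for every $t$; (b) $t\mapsto\|x(t)\|$ is continuous for every $x\in\Theta$; (c) $x\in\prod_t A_t$ belongs to $\Theta$ whenever for all $t\in\Omega$ and $\varepsilon>0$ there is $x'\in\Theta$ with $\|x(s)-x'(s)\|\le\varepsilon$ for all $s$ in some neighbourhood of $t$. For $Y\subseteq\Omega$, the field $\mathcal U|_Y$ over $Y$ has fibres $(A_t)_{t\in Y}$, and its continuous vector fields are those $x\in\prod_{t\in Y}A_t$ such that for all $t_0\in Y$ and $\varepsilon>0$ there is $x'\in\Theta$ with $\|x(t)-x'(t)\|\le\varepsilon$ for all $t$ in some neighbourhood of $t_0$ in $Y$. A field over $Y$ is trivial if there are a Banach algebra $B$ and isometric algebra isomorphisms of its fibres onto $B$ that carry its continuous vector fields onto the continuous maps $Y\to B$. Suppose that $\mathcal U$ is locally trivial (every point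 of $\Omega$ has an open neighbourhood $V$ with $\mathcal U|_V$ trivial), that every $A_t$ is non-zero and has an identity $e_{A_t}$, and that $\sup_{t\in\Omega}\|e_{A_t}\|\le C$ for some constant $C$. Let $\mathfrak A$ be the Banach algebra of all $x\in\Theta$ such that $\|x(t)\|$ vanishes at infinity on $\Omega$, with the norm $\|x\|=\sup_{t}\|x(t)\|$. Then the following conditions are equivalent: (i) $\Omega$ is paracompact; (ii) $\mathfrak A$ is left projective: for each left Banach $\mathfrak A$-module $Y$, every bounded left $\mathfrak A$-module morphism $\varphi:Y\to\mathfrak A$ that has a bounded linear right inverse has a right inverse that is a bounded left $\mathfrak A$-module morphism; (iii) $\mathfrak A$ is left projective and $\mathcal U$ is a disjoint union of $\sigma$-locally trivial fields: $\Omega$ is a disjoint union of open sets $W_\mu$ such that for each $\mu$ there are an open cover $\{U_\alpha\}$ of $W_\mu$ with every $\mathcal U|_{U_\alpha}$ trivial, and a countable open cover $\{V_j\}$ of $W_\mu$ such that for each $j$ the closure of $V_j$ in $W_\mu$ is contained in some $U_\alpha$; (iv) $\mathcal H^2(\mathfrak A,X)=\{0\}$ for every Banach $\mathfrak A$-bimodule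 $X$ with $X\cdot\mathfrak A=\{0\}$, where $\mathcal H^2(\mathfrak A,X)$ is the second continuous Hochschild cohomology group of $\mathfrak A$ with coefficients in $X$. -/

import Mathlib

open scoped ENNReal
open Filter Topology Set

universe u v w

/-!  Throughout, Banach algebras are complex, associative and not assumed to be unital: a Banach algebra
is a type `A` with `[NonUnitalNormedRing A] [NormedSpace ℂ A] [IsScalarTower ℂ A A]
[SMulCommClass ℂ A A] [CompleteSpace A]`. -/

section Fields

/-- A continuous field of Banach algebras over `Ω` with fibres `A t`: a subalgebra `Θ` of `∏ t, A t`
(the continuous vector fields) with the usual three axioms. -/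
structure ContinuousField (Ω : Type u) [TopologicalSpace Ω] (A : Ω → Type v)
    [∀ t, NonUnitalNormedRing (A t)] [∀ t, NormedSpace ℂ (A t)] where
  /-- The algebra of continuous vector fields. -/
  Θ : NonUnitalSubalgebra ℂ (∀ t, A t)
  dense_eval : ∀ t, Dense {a : A t | ∃ x ∈ Θ, x t = a}
  continuous_norm : ∀ x ∈ Θ, Continuous fun t => ‖x t‖
  mem_of_locally_approx : ∀ x : ∀ t, A t,
    (∀ t, ∀ ε > 0, ∃ x' ∈ Θ, ∀ᶠ s in 𝓝 t, ‖x s - x' s‖ ≤ ε) → x ∈ Θ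

/-- An isomorphism between two continuous fields over `Ω`: a family of isometric isomorphisms of
Banach algebras between the fibres that carries `Θ` onto `Θ'`. -/
structure ContinuousField.Iso {Ω : Type u} [TopologicalSpace Ω] {A A' : Ω → Type v}
    [∀ t, NonUnitalNormedRing (A t)] [∀ t, NormedSpace ℂ (A t)]
    [∀ t, NonUnitalNormedRing (A' t)] [∀ t, NormedSpace ℂ (A' t)]
    (U : ContinuousField Ω A) (U' : ContinuousField Ω A') where
  /-- The fibrewise isometric isomorphisms. -/
  toFun : ∀ t, A t ≃ₗᵢ[ℂ] A' t
  map_mul : ∀ t (a b : A t), toFun t (a * b) = toFun t a * toFun t b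
  mem_iff : ∀ x : ∀ t, A t, x ∈ U.Θ ↔ (fun t => toFun t (x t)) ∈ U'.Θ

/-- The constant field over `Ω` defined by the Banach algebra `B`. -/
def ContinuousField.const (Ω : Type u) [TopologicalSpace Ω] (B : Type v) [NonUnitalNormedRing B]
    [NormedSpace ℂ B] : ContinuousField Ω (fun _ => B) where
  Θ :=
    { carrier := {x | Continuous x}
      add_mem' := fun {_ _} hx hy => Continuous.add hx hy
      zero_mem' := continuous_const
      mul_mem' := fun {_ _} hx hy => Continuous.mul hx hy
      smul_mem' := fun c _ hx => Continuous.const_smul hx c }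
  dense_eval := fun t => by
    have h : {a : B | ∃ x ∈ ({ carrier := {x : Ω → B | Continuous x}
                               add_mem' := fun {_ _} hx hy => Continuous.add hx hy
                               zero_mem' := continuous_const
                               mul_mem' := fun {_ _} hx hy => Continuous.mul hx hy
                               smul_mem' := fun c _ hx => Continuous.const_smul hx c } :
                              NonUnitalSubalgebra ℂ (Ω → B)), x t = a} = univ := by
      ext a
      refine ⟨fun _ => mem_univ _, fun _ => ?_⟩
      exact ⟨fun _ => a, continuous_const, rfl⟩
    rw [h]
    exact dense_univ
  continuous_norm := fun _ hx => Continuous.norm hx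
  mem_of_locally_approx := fun x hx => by
    change Continuous x
    rw [continuous_iff_continuousAt]
    intro t
    rw [Metric.continuousAt_iff']
    intro ε hε
    obtain ⟨x', hx', h⟩ := hx t (ε / 4) (by positivity)
    have hc : Continuous x' := hx'
    have h2 := Metric.continuousAt_iff'.1 (hc.continuousAt (x := t)) (ε / 4) (by positivity)
    have h3 := h.self_of_nhds
    filter_upwards [h, h2] with s hs hs2
    rw [dist_eq_norm] at hs2 ⊢
    have e : x s - x t = (x s - x' s) + (x' s - x' t) - (x t - x' t) := by abel
    rw [e]
    calc _ ≤ ‖(x s - x' s) + (x' s - x' t)‖ + ‖x t - x' t‖ := norm_sub_le _ _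
      _ ≤ ‖x s - x' s‖ + ‖x' s - x' t‖ + ‖x t - x' t‖ := by gcongr; exact norm_add_le _ _
      _ < ε := by linarith

variable {Ω : Type u} [TopologicalSpace Ω] {A : Ω → Type v}
  [∀ t, NonUnitalNormedRing (A t)] [∀ t, NormedSpace ℂ (A t)]

namespace ContinuousField

/-- Continuity of a vector field `x` over `Y ⊆ Ω` at the point `t₀ ∈ Y`; neighbourhoods are taken
in the subspace `Y`. -/
def ContinuousOnAt (U : ContinuousField Ω A) {Y : Set Ω} (x : ∀ t : Y, A t) (t₀ : Y) : Prop :=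
  ∀ ε > 0, ∃ x' ∈ U.Θ, ∀ᶠ t : Y in 𝓝 t₀, ‖x t - x' t‖ ≤ ε

theorem continuousOnAt_norm (U : ContinuousField Ω A) {Y : Set Ω} {x : ∀ t : Y, A t} {t₀ : Y}
    (hx : U.ContinuousOnAt x t₀) : ContinuousAt (fun t : Y => ‖x t‖) t₀ := by
  rw [Metric.continuousAt_iff']
  intro ε hε
  obtain ⟨x', hx', h⟩ := hx (ε / 4) (by positivity)
  have hc : Continuous fun t : Y => ‖x' t‖ := (U.continuous_norm x' hx').comp continuous_subtype_val
  have h2 := Metric.continuousAt_iff'.1 (hc.continuousAt (x := t₀)) (ε / 4) (by positivity)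
  have h3 := h.self_of_nhds
  filter_upwards [h, h2] with s hs hs2
  rw [Real.dist_eq, abs_lt] at hs2 ⊢
  have a1 := abs_le.1 ((abs_norm_sub_norm_le (x s) (x' s)).trans hs)
  have a2 := abs_le.1 ((abs_norm_sub_norm_le (x t₀) (x' t₀)).trans h3)
  constructor <;> linarith [a1.1, a1.2, a2.1, a2.2, hs2.1, hs2.2]

theorem continuousOnAt_mul (U : ContinuousField Ω A) {Y : Set Ω} {x y : ∀ t : Y, A t} {t₀ : Y}
    (hx : U.ContinuousOnAt x t₀) (hy : U.ContinuousOnAt y t₀) :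
    U.ContinuousOnAt (fun t => x t * y t) t₀ := by
  intro ε hε
  set M : ℝ := ‖x t₀‖ + 1 with hM
  have hM0 : 0 < M := by positivity
  obtain ⟨y', hy', h1⟩ := hy (ε / (2 * M)) (by positivity)
  set N : ℝ := ‖y' t₀‖ + 1 with hN
  have hN0 : 0 < N := by positivity
  obtain ⟨x', hx', h2⟩ := hx (ε / (2 * N)) (by positivity)
  have hxn : ∀ᶠ t : Y in 𝓝 t₀, ‖x t‖ < M :=
    (U.continuousOnAt_norm hx).eventually_lt_const (by simp [hM])
  have hc : Continuous fun t : Y => ‖y' t‖ := (U.continuous_norm y' hy').comp continuous_subtype_val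
  have hyn : ∀ᶠ t : Y in 𝓝 t₀, ‖y' t‖ < N :=
    hc.continuousAt.eventually_lt_const (by simp [hN])
  refine ⟨x' * y', U.Θ.mul_mem hx' hy', ?_⟩
  filter_upwards [h1, h2, hxn, hyn] with t a1 a2 a3 a4
  have e : x t * y t - (x' * y') t = x t * (y t - y' t) + (x t - x' t) * y' t := by
    simp only [Pi.mul_apply, mul_sub, sub_mul]; abel
  rw [e]
  calc _ ≤ ‖x t * (y t - y' t)‖ + ‖(x t - x' t) * y' t‖ := norm_add_le _ _
    _ ≤ ‖x t‖ * ‖y t - y' t‖ + ‖x t - x' t‖ * ‖y' t‖ := by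
        gcongr <;> exact norm_mul_le _ _
    _ ≤ M * (ε / (2 * M)) + ε / (2 * N) * N := by gcongr
    _ = ε := by field_simp; ring

/-- The field `U|_Y` induced by `U` on `Y ⊆ Ω`: its continuous vector fields are the vector fields
over `Y` that are continuous at every point of `Y`. -/
def restrict (U : ContinuousField Ω A) (Y : Set Ω) : ContinuousField Y (fun t => A t) where
  Θ :=
    { carrier := {x | ∀ t₀ : Y, U.ContinuousOnAt x t₀}
      add_mem' := fun {x y} hx hy t₀ ε hε => by
        obtain ⟨x', hx', h1⟩ := hx t₀ (ε / 2) (by positivity)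
        obtain ⟨y', hy', h2⟩ := hy t₀ (ε / 2) (by positivity)
        refine ⟨x' + y', U.Θ.add_mem hx' hy', ?_⟩
        filter_upwards [h1, h2] with t a1 a2
        have e : (x + y) t - (x' + y') t = (x t - x' t) + (y t - y' t) := by
          simp only [Pi.add_apply]; abel
        rw [e]
        exact (norm_add_le _ _).trans (by linarith)
      zero_mem' := fun t₀ ε hε => ⟨0, U.Θ.zero_mem, by simp [hε.le]⟩
      mul_mem' := fun {x y} hx hy t₀ => U.continuousOnAt_mul (hx t₀) (hy t₀)
      smul_mem' := fun c x hx t₀ ε hε => by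
        obtain ⟨x', hx', h1⟩ := hx t₀ (ε / (‖c‖ + 1)) (by positivity)
        refine ⟨c • x', SMulMemClass.smul_mem c hx', ?_⟩
        filter_upwards [h1] with t a1
        have e : (c • x) t - (c • x') t = c • (x t - x' t) := by
          simp only [Pi.smul_apply, smul_sub]
        rw [e, norm_smul]
        calc _ ≤ (‖c‖ + 1) * (ε / (‖c‖ + 1)) := by gcongr; linarith
          _ = ε := by field_simp }
  dense_eval := fun t => (U.dense_eval t).mono (by
    rintro a ⟨x, hx, rfl⟩
    refine ⟨fun s => x s, ?_, rfl⟩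
    exact fun t₀ ε hε => ⟨x, hx, Eventually.of_forall fun s => by simp [hε.le]⟩)
  continuous_norm := fun x hx => continuous_iff_continuousAt.2 fun t => U.continuousOnAt_norm (hx t)
  mem_of_locally_approx := fun x hx t₀ ε hε => by
    obtain ⟨y, hy, h1⟩ := hx t₀ (ε / 2) (by positivity)
    obtain ⟨x', hx', h2⟩ := hy t₀ (ε / 2) (by positivity)
    refine ⟨x', hx', ?_⟩
    filter_upwards [h1, h2] with t a1 a2
    have e : x t - x' t = (x t - y t) + (y t - x' t) := by abel
    rw [e]
    exact (norm_add_le _ _).trans (by linarith)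

/-- `U` is trivial: it is isomorphic to the constant field defined by some Banach algebra. (The
fibres and `B` live in the same universe; over a non-empty base this is no restriction, as `B` is
isomorphic to each fibre.) -/
def IsTrivial (U : ContinuousField Ω A) : Prop :=
  ∃ (B : Type v) (_ : NonUnitalNormedRing B) (_ : NormedSpace ℂ B) (_ : IsScalarTower ℂ B B)
    (_ : SMulCommClass ℂ B B) (_ : CompleteSpace B), Nonempty (U.Iso (const Ω B))

/-- Every point has an open neighbourhood on which the field is trivial. -/
def IsLocallyTrivial (U : ContinuousField Ω A) : Prop :=
  ∀ t : Ω, ∃ V : Set Ω, IsOpen V ∧ t ∈ V ∧ (U.restrict V).IsTrivial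

/-- `U` is σ-locally trivial: there are an open cover `𝒰` of `Ω` by sets on which `U` is trivial and
a countable open cover `𝒱` of `Ω` such that the closure of each member of `𝒱` lies in a member
of `𝒰`. -/
def IsSigmaLocallyTrivial (U : ContinuousField Ω A) : Prop :=
  ∃ 𝒰 : Set (Set Ω), (∀ O ∈ 𝒰, IsOpen O ∧ (U.restrict O).IsTrivial) ∧ ⋃₀ 𝒰 = univ ∧
    ∃ 𝒱 : Set (Set Ω), 𝒱.Countable ∧ (∀ V ∈ 𝒱, IsOpen V ∧ ∃ O ∈ 𝒰, closure V ⊆ O) ∧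
      ⋃₀ 𝒱 = univ

/-- `U` is a disjoint union of σ-locally trivial fields: `Ω` is the union of a family of pairwise
disjoint open sets `W` such that each `U|_W` is σ-locally trivial. -/
def IsDisjointUnionOfSigmaLocallyTrivial (U : ContinuousField Ω A) : Prop :=
  ∃ 𝒲 : Set (Set Ω), (∀ W ∈ 𝒲, IsOpen W) ∧ 𝒲.PairwiseDisjoint id ∧ ⋃₀ 𝒲 = univ ∧
    ∀ W ∈ 𝒲, (U.restrict W).IsSigmaLocallyTrivial

/-- A continuous vector field vanishing at infinity is bounded. -/
theorem memℓp_of_tendsto (U : ContinuousField Ω A) {x : ∀ t, A t} (hx : x ∈ U.Θ)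
    (h0 : Tendsto (fun t => ‖x t‖) (cocompact Ω) (𝓝 0)) : Memℓp x ∞ := by
  rw [memℓp_infty_iff]
  have h1 : ∀ᶠ t in cocompact Ω, ‖x t‖ < 1 := h0.eventually_lt_const one_pos
  obtain ⟨K, hK, hKs⟩ := mem_cocompact.1 h1
  obtain ⟨C, hC⟩ := (hK.image (U.continuous_norm x hx)).bddAbove
  refine ⟨max C 1, ?_⟩
  rintro _ ⟨t, rfl⟩
  by_cases ht : t ∈ K
  · exact (hC ⟨t, ht, rfl⟩).trans (le_max_left _ _)
  · exact (le_of_lt (hKs ht)).trans (le_max_right _ _)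

/-- The Banach algebra defined by `U`: the continuous vector fields `x ∈ Θ` whose norm vanishes at
infinity, with the norm `sup_t ‖x t‖`. It is realised inside the Banach algebra `lp A ∞` of all
bounded vector fields with the supremum norm; this is no restriction by `memℓp_of_tendsto`. -/
def sectionAlgebra (U : ContinuousField Ω A) : NonUnitalSubalgebra ℂ (lp A ∞) where
  carrier := {x | (x : ∀ t, A t) ∈ U.Θ ∧ Tendsto (fun t => ‖x t‖) (cocompact Ω) (𝓝 0)}
  add_mem' := fun {x y} hx hy => ⟨U.Θ.add_mem hx.1 hy.1, by
    refine squeeze_zero (fun _ => norm_nonneg _) (fun t => norm_add_le (x t) (y t)) ?_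
    simpa using hx.2.add hy.2⟩
  zero_mem' := ⟨U.Θ.zero_mem, by simpa using tendsto_const_nhds⟩
  mul_mem' := fun {x y} hx hy => ⟨U.Θ.mul_mem hx.1 hy.1, by
    refine squeeze_zero (fun _ => norm_nonneg _) (fun t => norm_mul_le (x t) (y t)) ?_
    simpa using hx.2.mul hy.2⟩
  smul_mem' := fun c x hx => ⟨SMulMemClass.smul_mem c hx.1, by
    have : Tendsto (fun t => ‖c‖ * ‖x t‖) (cocompact Ω) (𝓝 0) := by simpa using hx.2.const_mul ‖c‖
    simpa [norm_smul] using this⟩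

theorem sectionAlgebra_norm_def (U : ContinuousField Ω A) (x : U.sectionAlgebra) :
    ‖x‖ = ⨆ t, ‖(x : lp A ∞) t‖ :=
  lp.norm_eq_ciSup (x : lp A ∞)

noncomputable instance (U : ContinuousField Ω A) : NormedSpace ℂ U.sectionAlgebra where
  norm_smul_le c x := norm_smul_le c (x : lp A ∞)

instance [∀ t, IsScalarTower ℂ (A t) (A t)] (U : ContinuousField Ω A) :
    IsScalarTower ℂ U.sectionAlgebra U.sectionAlgebra where
  smul_assoc c x y := Subtype.ext (smul_assoc c (x : lp A ∞) (y : lp A ∞))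

instance [∀ t, SMulCommClass ℂ (A t) (A t)] (U : ContinuousField Ω A) :
    SMulCommClass ℂ U.sectionAlgebra U.sectionAlgebra where
  smul_comm c x y := Subtype.ext (smul_comm c (x : lp A ∞) (y : lp A ∞))

/-- The normed algebra defined by a continuous field of Banach algebras is complete. -/
instance [∀ t, CompleteSpace (A t)] (U : ContinuousField Ω A) : CompleteSpace U.sectionAlgebra := by
  have key : ∀ (f g : lp A ∞) (t : Ω), ‖f t - g t‖ ≤ dist f g := fun f g t => by
    rw [dist_eq_norm]
    exact lp.norm_apply_le_norm ENNReal.top_ne_zero (f - g) t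
  have hcl : IsClosed (U.sectionAlgebra : Set (lp A ∞)) := by
    refine isClosed_of_closure_subset fun f hf => ?_
    rw [Metric.mem_closure_iff] at hf
    refine ⟨U.mem_of_locally_approx _ fun t ε hε => ?_, ?_⟩
    · obtain ⟨g, hg, hd⟩ := hf ε hε
      exact ⟨g, hg.1, Eventually.of_forall fun s => (key f g s).trans hd.le⟩
    · rw [Metric.tendsto_nhds]
      intro ε hε
      obtain ⟨g, hg, hd⟩ := hf (ε / 2) (by positivity)
      filter_upwards [Metric.tendsto_nhds.1 hg.2 (ε / 2) (by positivity)] with s hs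
      simp only [dist_zero_right, norm_norm] at hs ⊢
      calc ‖f s‖ = ‖(f s - g s) + g s‖ := by rw [sub_add_cancel]
        _ ≤ ‖f s - g s‖ + ‖g s‖ := norm_add_le _ _
        _ < ε := by linarith [key f g s]
  exact hcl.completeSpace_coe

end ContinuousField

end Fields

section Modules

/-- A structure of left Banach `R`-module on the Banach space `X`: a bounded bilinear associative
multiplication `(a, x) ↦ a · x = act a x`. -/
structure LeftBanachModule (R : Type w) [NonUnitalNormedRing R] [NormedSpace ℂ R]
    (X : Type w) [NormedAddCommGroup X] [NormedSpace ℂ X] where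
  /-- The module multiplication. -/
  act : R →L[ℂ] X →L[ℂ] X
  mul_act : ∀ a b x, act (a * b) x = act a (act b x)

/-- A Banach `R`-bimodule structure on the Banach space `X`, with `left a x = a · x` and
`right a x = x · a`. -/
structure BanachBimodule (R : Type w) [NonUnitalNormedRing R] [NormedSpace ℂ R]
    (X : Type w) [NormedAddCommGroup X] [NormedSpace ℂ X] where
  /-- Left multiplication `a · x`. -/
  left : R →L[ℂ] X →L[ℂ] X
  /-- Right multiplication `x · a`. -/
  right : R →L[ℂ] X →L[ℂ] X
  mul_left : ∀ a b x, left (a * b) x = left a (left b x)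
  mul_right : ∀ a b x, right (a * b) x = right b (right a x)
  left_right : ∀ a b x, right b (left a x) = left a (right b x)

variable (R : Type w) [NonUnitalNormedRing R] [NormedSpace ℂ R]
  [IsScalarTower ℂ R R] [SMulCommClass ℂ R R]

/-- `R` as a left Banach module over itself. -/
noncomputable def LeftBanachModule.regular : LeftBanachModule R R where
  act := ContinuousLinearMap.mul ℂ R
  mul_act := fun a b x => by simp [mul_assoc]

variable {R}

/-- The left Banach module `P` is projective: every morphism of left Banach modules `φ : Y → P`
which has a right inverse as a morphism of Banach spaces (in particular, `φ` is onto) has a right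
inverse which is a morphism of left Banach modules. -/
def LeftBanachModule.IsProjective {P : Type w} [NormedAddCommGroup P] [NormedSpace ℂ P]
    (mP : LeftBanachModule R P) : Prop :=
  ∀ (Y : Type w) [NormedAddCommGroup Y] [NormedSpace ℂ Y] [CompleteSpace Y]
    (mY : LeftBanachModule R Y) (φ : Y →L[ℂ] P),
    (∀ a y, φ (mY.act a y) = mP.act a (φ y)) →
    (∃ σ : P →L[ℂ] Y, ∀ p, φ (σ p) = p) →
    ∃ ψ : P →L[ℂ] Y, (∀ a p, ψ (mP.act a p) = mY.act a (ψ p)) ∧ ∀ p, φ (ψ p) = p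

/-- A Banach algebra is left projective if it is projective as a left Banach module over itself. -/
def IsLeftProjective (R : Type w) [NonUnitalNormedRing R] [NormedSpace ℂ R]
    [IsScalarTower ℂ R R] [SMulCommClass ℂ R R] : Prop :=
  (LeftBanachModule.regular R).IsProjective

namespace BanachBimodule

variable {X : Type w} [NormedAddCommGroup X] [NormedSpace ℂ X]

/-- `X · R = {0}`. -/
def IsRightAnnihilator (m : BanachBimodule R X) : Prop := ∀ a x, m.right a x = 0

open ContinuousLinearMap in
/-- The coboundary `δ¹` from bounded linear operators `R → X` to bounded bilinear operators
`R × R → X`, see `δ₁_apply`. -/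
noncomputable def δ₁ (m : BanachBimodule R X) : (R →L[ℂ] X) →ₗ[ℂ] (R →L[ℂ] R →L[ℂ] X) where
  toFun f := ((compL ℂ R X X).flip f).comp m.left - (compL ℂ R R X f).comp (mul ℂ R)
    + m.right.flip.comp f
  map_add' f g := by ext a b; simp; abel
  map_smul' c f := by ext a b; simp [smul_sub]

theorem δ₁_apply (m : BanachBimodule R X) (f : R →L[ℂ] X) (a b : R) :
    m.δ₁ f a b = m.left a (f b) - f (a * b) + m.right b (f a) := by
  simp [δ₁]

open ContinuousLinearMap in
/-- The coboundary `δ²` from bounded bilinear operators `R × R → X` to bounded trilinear operators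
`R × R × R → X`, see `δ₂_apply`. -/
noncomputable def δ₂ (m : BanachBimodule R X) :
    (R →L[ℂ] R →L[ℂ] X) →ₗ[ℂ] (R →L[ℂ] R →L[ℂ] R →L[ℂ] X) where
  toFun g := ((compL ℂ R (R →L[ℂ] X) (R →L[ℂ] X)).flip g).comp ((compL ℂ R X X).comp m.left)
    - (compL ℂ R R (R →L[ℂ] X) g).comp (mul ℂ R)
    + (((compL ℂ R (R →L[ℂ] R) (R →L[ℂ] X)).flip (mul ℂ R)).comp (compL ℂ R R X)).comp g
    - (compL ℂ R X (R →L[ℂ] X) m.right.flip).comp g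
  map_add' f g := by ext a b c; simp; abel
  map_smul' c f := by ext a b d; simp [smul_sub]

theorem δ₂_apply (m : BanachBimodule R X) (g : R →L[ℂ] R →L[ℂ] X) (a b c : R) :
    m.δ₂ g a b c = m.left a (g b c) - g (a * b) c + g a (b * c) - m.right c (g a b) := by
  simp [δ₂]

/-- The bounded 2-cocycles. -/
noncomputable def Z2 (m : BanachBimodule R X) : Submodule ℂ (R →L[ℂ] R →L[ℂ] X) :=
  LinearMap.ker m.δ₂

/-- The bounded 2-coboundaries. -/
noncomputable def B2 (m : BanachBimodule R X) : Submodule ℂ (R →L[ℂ] R →L[ℂ] X) :=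
  LinearMap.range m.δ₁

/-- `δ² ∘ δ¹ = 0`. -/
theorem B2_le_Z2 (m : BanachBimodule R X) : m.B2 ≤ m.Z2 := by
  rintro _ ⟨f, rfl⟩
  change m.δ₂ (m.δ₁ f) = 0
  ext a b c
  simp only [δ₂_apply, δ₁_apply, map_add, map_sub, m.mul_left, m.mul_right, m.left_right, mul_assoc,
    zero_apply]
  abel

/-- The second continuous Hochschild cohomology group `H²(R, X) = ker δ² / im δ¹`, as an additive
group. -/
abbrev H2 (m : BanachBimodule R X) : Type w :=
  m.Z2.toAddSubgroup ⧸ m.B2.toAddSubgroup.addSubgroupOf m.Z2.toAddSubgroup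

theorem subsingleton_H2_iff (m : BanachBimodule R X) :
    Subsingleton m.H2 ↔ ∀ g, m.δ₂ g = 0 → ∃ f, m.δ₁ f = g := by
  constructor
  · intro h g hg
    have h1 : ((⟨g, hg⟩ : m.Z2.toAddSubgroup) : m.H2) = ((0 : m.Z2.toAddSubgroup) : m.H2) :=
      Subsingleton.elim _ _
    have h2 := (QuotientAddGroup.eq.1 h1.symm)
    rw [neg_zero, zero_add] at h2
    exact h2
  · intro h
    refine ⟨fun x y => ?_⟩
    induction x using QuotientAddGroup.induction_on with | H x => ?_
    induction y using QuotientAddGroup.induction_on with | H y => ?_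
    exact QuotientAddGroup.eq.2 (h _ (-x + y).2)

end BanachBimodule

/-- `H²(R, X) = {0}` for every right annihilator Banach `R`-bimodule `X`. -/
def H2VanishesOnRightAnnihilators (R : Type w) [NonUnitalNormedRing R] [NormedSpace ℂ R]
    [IsScalarTower ℂ R R] [SMulCommClass ℂ R R] : Prop :=
  ∀ (X : Type w) [NormedAddCommGroup X] [NormedSpace ℂ X] [CompleteSpace X]
    (m : BanachBimodule R X), m.IsRightAnnihilator → Subsingleton m.H2

end Modules

/-! A locally compact Hausdorff space is paracompact exactly when it splits into clopen σ-compact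
parts; `ExhaustedPartition` records such a splitting together with a rank of growth.

Paracompact implies projective. The rank is dominated by a continuous `g`, and hat functions of `g`
on the parts give functions `k i`, at most two of them non-zero at each point, with `∑ k i ^ 2 = 1`
(`exists_square_partition`). Put `E i = k i • e`. The formal sum `∑ E i ⊗ E i` is controlled by
averaging over signs (`norm_sum_le_of_signed_sums`), so for a bounded linear right inverse `σ` the
map `a ↦ ∑ (a * E i) · σ (E i)` is a module morphism that is still a right inverse.

Projective implies paracompact. Take bounded families `F` indexed by isometries `T : A t ≃ A s`,
with `F T ∈ A s`, continuous at the diagonal and vanishing as `t → ∞`; the algebra acts through `s`.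
Restriction to the diagonal is a module morphism onto the section algebra, split linearly by `a ↦ T
(a t)`. A module splitting, applied to cut-offs of the unit, yields a kernel that equals `e s` on
the diagonal, stays large near it, and is small for `s` in a compact set and `t` outside another.
"The kernel is large both ways" is then a relation to which
`ExhaustedPartition.nonempty_of_relation` applies.

The decomposition in (iii) is read off the partition, each part being Lindelöf. The equivalence with
(iv) holds for all Banach algebras: 2-cocycles into right annihilator bimodules correspond to
linearly split extensions of the regular left module. -/

/-- A partition of `Ω` into open sets together with a locally bounded rank function whose sublevel
sets are relatively compact in each part. -/
structure ExhaustedPartition (Ω : Type u) [TopologicalSpace Ω] where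
  /-- The partition. -/
  rel : Setoid Ω
  /-- The rank function. -/
  rank : Ω → ℕ
  eventually_rel : ∀ x, ∀ᶠ y in 𝓝 x, rel x y
  eventually_rank_le : ∀ x, ∀ᶠ y in 𝓝 x, rank y ≤ rank x + 1
  exists_isCompact : ∀ x n, ∃ L : Set Ω, IsCompact L ∧ {y | rel x y ∧ rank y ≤ n} ⊆ L

/-! ### Exhausted partitions and paracompactness. -/

section Topology

variable {Ω : Type u} [TopologicalSpace Ω]

/-- A symmetric neighbourhood relation that maps compact sets to relatively compact sets generates
an exhausted partition. -/
theorem ExhaustedPartition.nonempty_of_relation (R : Ω → Ω → Prop) (hsymm : ∀ x y, R x y → R y x)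
    (hnhds : ∀ x, ∀ᶠ y in 𝓝 x, R x y)
    (hcomp : ∀ K : Set Ω, IsCompact K → ∃ L : Set Ω, IsCompact L ∧ ∀ x ∈ K, ∀ y, R x y → y ∈ L) :
    Nonempty (ExhaustedPartition Ω) := by
  classical
  have : Std.Symm R := ⟨hsymm⟩
  -- The parts are the chain components of `R`. Iterating the compact enlargement `n` times from `x`
  -- gives a compact `B x n` that contains all points reachable in at most `n` steps; the rank is
  -- the least such `n` counted from a representative of the part.
  let s : Setoid Ω :=
    ⟨Relation.ReflTransGen R, fun _ => .refl, fun h => Std.Symm.symm (r := Relation.ReflTransGen R) _ _ h,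
      fun h h' => h.trans h'⟩
  choose L hL hRL using hcomp
  let B : Ω → ℕ → {K : Set Ω // IsCompact K} := fun x n =>
    Nat.rec ⟨{x}, isCompact_singleton⟩ (fun _ K => ⟨L K.1 K.2, hL K.1 K.2⟩) n
  have hB : ∀ x n, ∀ y ∈ (B x n).1, ∀ z, R y z → z ∈ (B x (n + 1)).1 :=
    fun x n y hy z hz => hRL (B x n).1 (B x n).2 y hy z hz
  have hmono : ∀ x, Monotone fun n => (B x n).1 := fun x =>
    monotone_nat_of_le_succ fun n y hy => hB x n y hy y (hnhds y).self_of_nhds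
  have hex : ∀ x y, s x y → ∃ n, y ∈ (B x n).1 := fun x y h => by
    induction h with
    | refl => exact ⟨0, rfl⟩
    | tail _ hbc ih =>
      obtain ⟨n, hn⟩ := ih
      exact ⟨n + 1, hB x n _ hn _ hbc⟩
  let c : Ω → Ω := fun x => (Quotient.mk s x).out
  have hc : ∀ x, s (c x) x := fun x => Quotient.mk_out (s := s) x
  have hcc : ∀ {x y}, s x y → c x = c y := fun {x y} h => by
    have : Quotient.mk s x = Quotient.mk s y := Quotient.sound h
    simp only [c, this]
  have hex' : ∀ x, ∃ n, x ∈ (B (c x) n).1 := fun x => hex _ _ (hc x)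
  refine ⟨⟨s, fun x => Nat.find (hex' x), fun x => (hnhds x).mono fun y hy =>
    Relation.ReflTransGen.single hy, fun x => (hnhds x).mono fun y hy => ?_, fun x n =>
    ⟨(B (c x) n).1, (B (c x) n).2, ?_⟩⟩⟩
  · apply Nat.find_min'
    rw [← hcc (Relation.ReflTransGen.single hy : s x y)]
    exact hB _ _ x (Nat.find_spec (hex' x)) y hy
  · rintro y ⟨hxy, hy⟩
    rw [hcc hxy]
    exact hmono _ hy (Nat.find_spec (hex' y))

/-- A paracompact locally compact Hausdorff space has an exhausted partition. -/
theorem ExhaustedPartition.nonempty_of_paracompact [T2Space Ω] [LocallyCompactSpace Ω]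
    [ParacompactSpace Ω] : Nonempty (ExhaustedPartition Ω) := by
  choose K hK hxK using fun x : Ω => exists_compact_mem_nhds x
  obtain ⟨V, hVo, hVc, hVf, hVK⟩ := precise_refinement (fun x => interior (K x))
    (fun _ => isOpen_interior)
    (eq_univ_of_forall fun x => mem_iUnion.2 ⟨x, mem_interior_iff_mem_nhds.2 (hxK x)⟩)
  -- Points are related when they share a member of a locally finite cover by relatively compact
  -- open sets; a compact set meets only finitely many members.
  refine nonempty_of_relation (fun x y => ∃ i, x ∈ V i ∧ y ∈ V i)
    (fun x y ⟨i, h1, h2⟩ => ⟨i, h2, h1⟩) (fun x => ?_) fun C hC => ?_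
  · obtain ⟨i, hi⟩ := mem_iUnion.1 (hVc.symm ▸ mem_univ x : x ∈ ⋃ i, V i)
    exact mem_of_superset ((hVo i).mem_nhds hi) fun y hy => ⟨i, hi, hy⟩
  · have hfin := hVf.finite_nonempty_inter_compact hC
    refine ⟨⋃ i ∈ {i | (V i ∩ C).Nonempty}, K i, hfin.isCompact_biUnion fun i _ => hK i, ?_⟩
    rintro x hx y ⟨i, hi, hyi⟩
    exact mem_biUnion (show (V i ∩ C).Nonempty from ⟨x, hi, hx⟩) (interior_subset (hVK i hyi))

namespace ExhaustedPartition

variable (P : ExhaustedPartition Ω)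

/-- The part of the partition that contains `x`. -/
def part (x : Ω) : Set Ω := {y | P.rel x y}

theorem mem_part_self (x : Ω) : x ∈ P.part x := P.rel.refl x

theorem isOpen_part (x : Ω) : IsOpen (P.part x) :=
  isOpen_iff_mem_nhds.2 fun y hy => (P.eventually_rel y).mono fun _ hz => P.rel.trans hy hz

theorem isClosed_part (x : Ω) : IsClosed (P.part x) := by
  refine ⟨isOpen_iff_mem_nhds.2 fun y hy => (P.eventually_rel y).mono fun z hz hxz => ?_⟩
  exact hy (P.rel.trans hxz (P.rel.symm hz))

theorem part_eq {x y : Ω} (h : P.rel x y) : P.part x = P.part y :=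
  ext fun _ => ⟨fun hz => P.rel.trans (P.rel.symm h) hz, fun hz => P.rel.trans h hz⟩

theorem rel_of_mem_parts {x y z : Ω} (h : z ∈ P.part x) (h' : z ∈ P.part y) : P.rel x y :=
  P.rel.trans h (P.rel.symm h')

theorem isSigmaCompact_part (x : Ω) : IsSigmaCompact (P.part x) := by
  choose L hL h using P.exists_isCompact x
  refine (isSigmaCompact_iUnion_of_isCompact L hL).of_isClosed_subset (P.isClosed_part x) ?_
  exact fun y hy => mem_iUnion.2 ⟨P.rank y, h _ ⟨hy, le_rfl⟩⟩

theorem sigmaCompactSpace_part (x : Ω) : SigmaCompactSpace (P.part x) :=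
  isSigmaCompact_iff_sigmaCompactSpace.1 (P.isSigmaCompact_part x)

/-- Each part is locally compact and σ-compact, hence paracompact, and locally finite refinements on
disjoint open parts glue together. -/
theorem paracompactSpace [T2Space Ω] [LocallyCompactSpace Ω] (P : ExhaustedPartition Ω) :
    ParacompactSpace Ω := by
  refine ⟨fun α u uo uc => ?_⟩
  have hpara : ∀ x, ParacompactSpace (P.part x) := fun x => by
    have := P.sigmaCompactSpace_part x
    have := (P.isOpen_part x).locallyCompactSpace
    infer_instance
  let c : Ω → Ω := fun x => (Quotient.mk P.rel x).out
  have hc : ∀ x, P.rel (c x) x := fun x => Quotient.mk_out (s := P.rel) x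
  have hcc : ∀ {x y}, P.rel x y → c x = c y := fun {x y} h => by
    have : Quotient.mk P.rel x = Quotient.mk P.rel y := Quotient.sound h
    simp only [c, this]
  have key : ∀ x, ∃ v : α → Set (P.part x), (∀ a, IsOpen (v a)) ∧ ⋃ i, v i = univ ∧
      LocallyFinite v ∧ ∀ a, v a ⊆ Subtype.val ⁻¹' u a := fun x => by
    refine precise_refinement _ (fun a => (uo a).preimage continuous_subtype_val) ?_
    rw [← preimage_iUnion, uc, preimage_univ]
  choose v vo vc vf vu using key
  -- Each part is indexed by one representative `c x`, so that a single refinement is used on it.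
  let V : α → Set Ω := fun a => {x | (⟨x, hc x⟩ : P.part (c x)) ∈ v (c x) a}
  have hV : ∀ a x, V a ∩ P.part (c x) = Subtype.val '' (v (c x) a) := fun a x => by
    ext y
    -- The variable `z` allows substitution along `c y = z`, on which the type of the point depends.
    have aux : ∀ z (hz : y ∈ P.part z), c y = z → (y ∈ V a ↔ (⟨y, hz⟩ : P.part z) ∈ v z a) := by
      rintro z hz rfl
      rfl
    constructor
    · rintro ⟨h1, h2⟩
      exact ⟨⟨y, h2⟩, (aux _ h2 (hcc (P.rel.trans (P.rel.symm h2) (hc x)))).1 h1, rfl⟩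
    · rintro ⟨⟨y, h2⟩, h3, rfl⟩
      exact ⟨(aux _ h2 (hcc (P.rel.trans (P.rel.symm h2) (hc x)))).2 h3, h2⟩
  refine ⟨α, V, fun a => ?_, ?_, fun x => ?_, fun a => ⟨a, fun x hx => vu _ _ hx⟩⟩
  · refine isOpen_iff_mem_nhds.2 fun x hx => ?_
    have h1 : IsOpen (V a ∩ P.part (c x)) := by
      rw [hV]
      exact (P.isOpen_part _).isOpenMap_subtype_val _ (vo _ a)
    exact mem_of_superset (h1.mem_nhds ⟨hx, hc x⟩) inter_subset_left
  · refine eq_univ_of_forall fun x => ?_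
    obtain ⟨a, ha⟩ := mem_iUnion.1 ((vc (c x)).symm ▸ mem_univ (⟨x, hc x⟩ : P.part (c x)))
    exact mem_iUnion.2 ⟨a, ha⟩
  · obtain ⟨t, ht, hf⟩ := vf (c x) ⟨x, hc x⟩
    refine ⟨Subtype.val '' t, (P.isOpen_part (c x)).isOpenMap_subtype_val.image_mem_nhds ht, ?_⟩
    refine hf.subset ?_
    rintro a ⟨_, hy, ⟨y, hyt, rfl⟩⟩
    have h3 : (y : Ω) ∈ V a ∩ P.part (c x) := ⟨hy, y.2⟩
    rw [hV] at h3
    obtain ⟨z, hz, hzy⟩ := h3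
    rw [Subtype.ext hzy] at hz
    exact ⟨y, hz, hyt⟩

/-- In a paracompact Hausdorff space the rank is dominated by a continuous function. -/
theorem exists_continuous_rank_le [T2Space Ω] [ParacompactSpace Ω] :
    ∃ g : C(Ω, ℝ), ∀ x, (P.rank x : ℝ) ≤ g x :=
  -- Near `x` the constant `rank x + 1` dominates the rank; a partition of unity patches these
  -- constants.
  exists_continuous_forall_mem_convex_of_local_const (t := fun x => Ici (P.rank x : ℝ))
    (fun _ => convex_Ici _) fun x => ⟨P.rank x + 1, (P.eventually_rank_le x).mono fun y hy => by
      simpa using (by exact_mod_cast hy : (P.rank y : ℝ) ≤ P.rank x + 1)⟩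

end ExhaustedPartition

end Topology

/-! ### Projectivity and second cohomology. -/

section Cohomology

variable {R : Type w} [NonUnitalNormedRing R] [NormedSpace ℂ R]
  [IsScalarTower ℂ R R] [SMulCommClass ℂ R R]

namespace BanachBimodule

variable {X : Type w} [NormedAddCommGroup X] [NormedSpace ℂ X]

/-- The left Banach module extension of `R` by `X` defined by a bounded 2-cocycle. -/
noncomputable def extension (m : BanachBimodule R X) (hm : m.IsRightAnnihilator)
    (g : R →L[ℂ] R →L[ℂ] X) (hg : m.δ₂ g = 0) : LeftBanachModule R (X × R) where
  act := LinearMap.mkContinuous₂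
    (LinearMap.mk₂ ℂ (fun a (p : X × R) => (m.left a p.1 + g a p.2, a * p.2))
      (fun a b p => by ext <;> simp [add_mul]; abel)
      (fun c a p => by ext <;> simp [smul_mul_assoc])
      (fun a p q => by ext <;> simp [mul_add]; abel)
      (fun c a p => by ext <;> simp [mul_smul_comm]))
    (‖m.left‖ + ‖g‖ + 1) fun a p => by
      have h1 : ‖p.1‖ ≤ ‖p‖ := norm_fst_le p
      have h2 : ‖p.2‖ ≤ ‖p‖ := norm_snd_le p
      refine norm_prod_le_iff.2 ⟨?_, ?_⟩
      · calc ‖m.left a p.1 + g a p.2‖ ≤ ‖m.left a p.1‖ + ‖g a p.2‖ := norm_add_le _ _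
          _ ≤ ‖m.left‖ * ‖a‖ * ‖p.1‖ + ‖g‖ * ‖a‖ * ‖p.2‖ :=
            add_le_add (m.left.le_opNorm₂ _ _) (g.le_opNorm₂ _ _)
          _ ≤ ‖m.left‖ * ‖a‖ * ‖p‖ + ‖g‖ * ‖a‖ * ‖p‖ + 1 * ‖a‖ * ‖p‖ := by
            have : 0 ≤ 1 * ‖a‖ * ‖p‖ := by positivity
            have : ‖m.left‖ * ‖a‖ * ‖p.1‖ ≤ ‖m.left‖ * ‖a‖ * ‖p‖ := by gcongr
            have : ‖g‖ * ‖a‖ * ‖p.2‖ ≤ ‖g‖ * ‖a‖ * ‖p‖ := by gcongr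
            linarith
          _ = _ := by ring
      · calc ‖a * p.2‖ ≤ ‖a‖ * ‖p.2‖ := norm_mul_le _ _
          _ ≤ 1 * ‖a‖ * ‖p‖ := by rw [one_mul]; gcongr
          _ ≤ (‖m.left‖ + ‖g‖ + 1) * ‖a‖ * ‖p‖ := by
            gcongr
            have := norm_nonneg m.left
            have := norm_nonneg g
            linarith
  -- As the right action is zero, the cocycle identity is exactly associativity of the twisted
  -- action.
  mul_act := fun a b p => by
    have h := congr($hg a b p.2)
    rw [m.δ₂_apply, hm] at h
    simp only [zero_apply, sub_zero] at h
    refine Prod.ext ?_ (mul_assoc _ _ _)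
    simp only [LinearMap.mkContinuous₂_apply, LinearMap.mk₂_apply, m.mul_left, map_add]
    have h' : g (a * b) p.2 = m.left a (g b p.2) + g a (b * p.2) := by
      rw [← sub_eq_zero, ← neg_eq_zero, ← h]; abel
    rw [h']; abel

theorem extension_act (m : BanachBimodule R X) (hm : m.IsRightAnnihilator)
    (g : R →L[ℂ] R →L[ℂ] X) (hg : m.δ₂ g = 0) (a : R) (p : X × R) :
    (m.extension hm g hg).act a p = (m.left a p.1 + g a p.2, a * p.2) := rfl

end BanachBimodule

/-- The kernel of a morphism of left Banach modules into `R`, as a right annihilator bimodule. -/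
noncomputable def LeftBanachModule.kerBimodule {Y : Type w} [NormedAddCommGroup Y] [NormedSpace ℂ Y]
    (mY : LeftBanachModule R Y) (φ : Y →L[ℂ] R) (hφ : ∀ a y, φ (mY.act a y) = a * φ y) :
    BanachBimodule R φ.ker where
  left := LinearMap.mkContinuous₂
    (LinearMap.mk₂ ℂ (fun a (y : φ.ker) => (⟨mY.act a y, by
        have : φ (y : Y) = 0 := y.2
        simp [hφ, this]⟩ : φ.ker))
      (fun a b p => by ext; simp)
      (fun c a p => by ext; simp)
      (fun a p q => by ext; simp)
      (fun c a p => by ext; simp))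
    ‖mY.act‖ fun a y => mY.act.le_opNorm₂ a y
  right := 0
  mul_left := fun a b y => Subtype.ext (mY.mul_act a b y)
  mul_right := fun a b x => by simp
  left_right := fun a b x => by simp

/-- A Banach algebra is left projective if and only if its second cohomology groups with
coefficients in right annihilator bimodules vanish. -/
theorem isLeftProjective_iff_H2Vanishes [CompleteSpace R] :
    IsLeftProjective R ↔ H2VanishesOnRightAnnihilators R := by
  constructor
  · intro h X _ _ _ m hm
    rw [m.subsingleton_H2_iff]
    intro g hg
    -- A module splitting of the projection `X × R → R` has a first component whose negative
    -- cobounds `g`.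
    obtain ⟨ψ, hψ, hs⟩ := h (X × R) (m.extension hm g hg) (ContinuousLinearMap.snd ℂ X R)
      (fun a y => rfl) ⟨ContinuousLinearMap.inr ℂ X R, fun p => rfl⟩
    refine ⟨-((ContinuousLinearMap.fst ℂ X R).comp ψ), ?_⟩
    ext a b
    have h1 := congr(Prod.fst $(hψ a b))
    have h2 : (ψ b).2 = b := hs b
    rw [m.extension_act, h2] at h1
    have h3 : (ψ (a * b)).1 = m.left a (ψ b).1 + g a b := h1
    rw [m.δ₁_apply, hm]
    simp [h3]
  · intro h Y _ _ _ mY φ hφ ⟨σ, hσ⟩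
    have hφ' : ∀ a y, φ (mY.act a y) = a * φ y := hφ
    let m := mY.kerBimodule φ hφ'
    have : CompleteSpace φ.ker := φ.isClosed_ker.completeSpace_coe
    -- The failure of `σ` to be a morphism is a cocycle with values in the kernel. If `f` cobounds
    -- it, then `σ - f` is a morphism, and it still splits `φ`.
    let g : R →L[ℂ] R →L[ℂ] φ.ker := LinearMap.mkContinuous₂
      (LinearMap.mk₂ ℂ (fun a b => (⟨mY.act a (σ b) - σ (a * b), by simp [hφ', hσ]⟩ : φ.ker))
        (fun a b p => by ext; simp [add_mul]; abel)
        (fun c a p => by ext; simp [smul_sub, smul_mul_assoc])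
        (fun a p q => by ext; simp [mul_add]; abel)
        (fun c a p => by ext; simp [smul_sub, mul_smul_comm]))
      (‖mY.act‖ * ‖σ‖ + ‖σ‖) fun a b => by
        change ‖mY.act a (σ b) - σ (a * b)‖ ≤ _
        calc _ ≤ ‖mY.act a (σ b)‖ + ‖σ (a * b)‖ := norm_sub_le _ _
          _ ≤ ‖mY.act‖ * ‖a‖ * (‖σ‖ * ‖b‖) + ‖σ‖ * (‖a‖ * ‖b‖) := by
            gcongr
            · exact (mY.act.le_opNorm₂ _ _).trans (by gcongr; exact σ.le_opNorm b)
            · exact (σ.le_opNorm _).trans (by gcongr; exact norm_mul_le a b)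
          _ = _ := by ring
    have hg : ∀ a b, (g a b : Y) = mY.act a (σ b) - σ (a * b) := fun _ _ => rfl
    have hm : ∀ a y, (m.left a y : Y) = mY.act a y := fun _ _ => rfl
    obtain ⟨f, hf⟩ := m.subsingleton_H2_iff.1 (h φ.ker m fun _ _ => rfl) g (by
      ext a b c
      have hr : ∀ c y, m.right c y = 0 := fun _ _ => rfl
      simp only [m.δ₂_apply, hr, sub_zero, zero_apply, Submodule.coe_add, Submodule.coe_sub, hg, hm,
        map_sub, mY.mul_act, mul_assoc, Submodule.coe_zero]
      abel)
    refine ⟨σ - φ.ker.subtypeL.comp f, fun a b => ?_, fun b => ?_⟩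
    · have h1 := congr((($hf a b : φ.ker) : Y))
      have hr : m.right b (f a) = 0 := rfl
      rw [m.δ₁_apply, hr, add_zero, hg, Submodule.coe_sub, hm] at h1
      change σ (a * b) - (f (a * b) : Y) = mY.act a (σ b - f b)
      have h2 : σ (a * b) = mY.act a (σ b) - (mY.act a (f b) - f (a * b)) := by rw [h1]; abel
      rw [h2, map_sub]; abel
    · have : φ (f b : Y) = 0 := (f b).2
      simp [hσ, this]

end Cohomology

/-! ### Partitions of unity by squares. -/

section SquarePartition

variable {Ω : Type u} [TopologicalSpace Ω]

/-- A paracompact locally compact Hausdorff space has a locally finite family of non-negative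
compactly supported functions whose squares sum to `1` and whose sums are uniformly bounded. -/
theorem exists_square_partition [T2Space Ω] [LocallyCompactSpace Ω] [ParacompactSpace Ω] :
    ∃ (ι : Type u) (k : ι → Ω → ℝ), (∀ i, Continuous (k i)) ∧ (∀ i, HasCompactSupport (k i)) ∧
      (∀ K : Set Ω, IsCompact K → {i | ∃ t ∈ K, k i t ≠ 0}.Finite) ∧ (∀ i t, 0 ≤ k i t) ∧
      (∀ t, HasSum (fun i => k i t ^ 2) 1) ∧ ∀ t (F : Finset ι), ∑ i ∈ F, k i t ≤ 2 := by
  classical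
  obtain ⟨P⟩ := ExhaustedPartition.nonempty_of_paracompact (Ω := Ω)
  obtain ⟨g, hg⟩ := P.exists_continuous_rank_le
  have hg0 : ∀ t, 0 ≤ g t := fun t => (Nat.cast_nonneg _).trans (hg t)
  -- On one part, the square root of the hat function of `g` centred at the integer `i.2`. The
  -- support is relatively compact because `g` dominates the rank.
  let k : Quotient P.rel × ℕ → Ω → ℝ := fun i t =>
    if Quotient.mk P.rel t = i.1 then √(max 0 (1 - |g t - i.2|)) else 0
  have hk0 : ∀ i t, 0 ≤ k i t := fun i t => by
    dsimp only [k]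
    split_ifs
    exacts [Real.sqrt_nonneg _, le_rfl]
  have hkne : ∀ i t, k i t ≠ 0 → Quotient.mk P.rel t = i.1 ∧ |g t - i.2| < 1 := fun i t h => by
    dsimp only [k] at h
    split_ifs at h with hq
    · refine ⟨hq, ?_⟩
      by_contra! h1
      exact h (by rw [max_eq_left (by linarith), Real.sqrt_zero])
    · exact absurd rfl h
  have hfl : ∀ t, (⌊g t⌋₊ : ℝ) ≤ g t ∧ g t < ⌊g t⌋₊ + 1 := fun t =>
    ⟨Nat.floor_le (hg0 t), Nat.lt_floor_add_one _⟩
  -- Only the two integers around `g t` contribute. Their hats have sum `1`, and two square roots,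
  -- each at most `1`, give the bound `2`.
  let S : Ω → Finset (Quotient P.rel × ℕ) := fun t =>
    {(Quotient.mk P.rel t, ⌊g t⌋₊), (Quotient.mk P.rel t, ⌊g t⌋₊ + 1)}
  have hS : ∀ t, ∀ i ∉ S t, k i t = 0 := fun t i hi => by
    by_contra h
    obtain ⟨h1, h2⟩ := hkne i t h
    apply hi
    have h3 : ⌊g t⌋₊ ≤ i.2 := by
      rw [← Nat.lt_add_one_iff, ← Nat.cast_lt (α := ℝ), Nat.cast_add_one]
      linarith [(abs_lt.1 h2).2, (hfl t).1]
    have h4 : i.2 ≤ ⌊g t⌋₊ + 1 := by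
      rw [← Nat.lt_add_one_iff, ← Nat.cast_lt (α := ℝ)]
      push_cast
      linarith [(abs_lt.1 h2).1, (hfl t).2]
    simp only [S, Finset.mem_insert, Finset.mem_singleton, Prod.ext_iff, h1, true_and]
    omega
  have hSk : ∀ t (f : ℝ → ℝ), ∑ i ∈ S t, f (k i t) =
      f √(1 - (g t - ⌊g t⌋₊)) + f √(g t - ⌊g t⌋₊) := fun t f => by
    rw [Finset.sum_pair (by simp)]
    obtain ⟨h1, h2⟩ := hfl t
    have e1 : |g t - ⌊g t⌋₊| = g t - ⌊g t⌋₊ := abs_of_nonneg (by linarith)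
    have e2 : |g t - (⌊g t⌋₊ + 1)| = 1 - (g t - ⌊g t⌋₊) := by
      rw [abs_of_nonpos (by linarith)]; ring
    simp only [k, if_true, Nat.cast_add_one, e1, e2]
    rw [max_eq_right (by linarith), max_eq_right (by linarith)]
    congr 3
    ring
  refine ⟨Quotient P.rel × ℕ, k, fun i => ?_, fun i => ?_, fun K hK => ?_, hk0, fun t => ?_,
    fun t F => ?_⟩
  · have hc : Continuous fun t => √(max 0 (1 - |g t - i.2|)) := by fun_prop
    refine continuous_iff_continuousAt.2 fun t => ?_
    by_cases h : Quotient.mk P.rel t = i.1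
    · refine hc.continuousAt.congr ((P.eventually_rel t).mono fun y hy => ?_)
      have : Quotient.mk P.rel y = i.1 := by rw [← h]; exact (Quotient.sound hy).symm
      simp only [k, this, if_true]
    · refine (continuousAt_const (y := (0 : ℝ))).congr ((P.eventually_rel t).mono fun y hy => ?_)
      have : Quotient.mk P.rel y ≠ i.1 := by
        have : Quotient.mk P.rel t = Quotient.mk P.rel y := Quotient.sound hy
        rwa [← this]
      simp only [k, this, if_false]
  · obtain ⟨x, hx⟩ := Quotient.exists_rep i.1
    obtain ⟨L, hL, h⟩ := P.exists_isCompact x (i.2 + 1)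
    refine HasCompactSupport.intro hL fun t ht => ?_
    by_contra hne
    obtain ⟨h1, h2⟩ := hkne i t hne
    refine ht (h ⟨Quotient.exact (hx.trans h1.symm), ?_⟩)
    rw [← Nat.cast_le (α := ℝ), Nat.cast_add_one]
    linarith [(abs_lt.1 h2).2, hg t]
  · obtain ⟨T, -, hT⟩ := hK.elim_nhds_subcover P.part fun x _ =>
      (P.isOpen_part x).mem_nhds (P.mem_part_self x)
    obtain ⟨G, hG⟩ := (hK.image g.continuous).bddAbove
    refine ((T.finite_toSet.image (Quotient.mk P.rel)).prod
      (finite_Iic (⌈G⌉₊ + 1))).subset ?_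
    rintro i ⟨t, ht, hne⟩
    obtain ⟨h1, h2⟩ := hkne i t hne
    obtain ⟨x, hx, hxt⟩ := mem_iUnion₂.1 (hT ht)
    refine ⟨⟨x, hx, (Quotient.sound hxt).trans h1⟩, ?_⟩
    rw [mem_Iic, ← Nat.cast_le (α := ℝ), Nat.cast_add_one]
    linarith [(abs_lt.1 h2).1, hG ⟨t, ht, rfl⟩, Nat.le_ceil G]
  · have h : HasSum (fun i => k i t ^ 2) (∑ i ∈ S t, k i t ^ 2) :=
      hasSum_sum_of_ne_finset_zero fun i hi => by simp [hS t i hi]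
    rw [hSk t (fun y => y ^ 2)] at h
    rw [Real.sq_sqrt (by linarith [(hfl t).2]), Real.sq_sqrt (by linarith [(hfl t).1]),
      sub_add_cancel] at h
    exact h
  · have h : HasSum (fun i => k i t) (∑ i ∈ S t, k i t) := hasSum_sum_of_ne_finset_zero (hS t)
    refine (sum_le_hasSum F (fun i _ => hk0 i t) h).trans ?_
    rw [hSk t (fun y => y)]
    have h1 : √(1 - (g t - ⌊g t⌋₊)) ≤ 1 := Real.sqrt_le_one.2 (by linarith [(hfl t).1])
    have h2 : √(g t - ⌊g t⌋₊) ≤ 1 := Real.sqrt_le_one.2 (by linarith [(hfl t).2])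
    linarith

end SquarePartition

/-! ### Averaging over signs. -/

section SignedSums

variable {X Y Z : Type*} [NormedAddCommGroup X] [NormedSpace ℂ X] [NormedAddCommGroup Y]
  [NormedSpace ℂ Y] [NormedAddCommGroup Z] [NormedSpace ℂ Z]

/-- Averaging `β (x ± u j) (y ± v j)` over a common sign cancels the cross terms and leaves `β x y +
β (u j) (v j)`. The offsets `x`, `y` are there for the induction: they absorb the signed term that
is split off. -/
theorem norm_add_sum_le_of_signed_sums {ι : Type*} (β : X →L[ℂ] Y →L[ℂ] Z) (u : ι → X)
    (v : ι → Y) (M : ℝ) (F : Finset ι) : ∀ (x : X) (y : Y),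
    (∀ s : ι → ℂ, (∀ i, s i = 1 ∨ s i = -1) →
      ‖β (x + ∑ i ∈ F, s i • u i) (y + ∑ i ∈ F, s i • v i)‖ ≤ M) →
    ‖β x y + ∑ i ∈ F, β (u i) (v i)‖ ≤ M := by
  classical
  induction F using Finset.induction_on with
  | empty => exact fun x y h => by simpa using h (fun _ => 1) fun _ => .inl rfl
  | insert j F hj ih =>
    intro x y h
    have key : ∀ c : ℂ, (c = 1 ∨ c = -1) →
        ‖β (x + c • u j) (y + c • v j) + ∑ i ∈ F, β (u i) (v i)‖ ≤ M := fun c hc => by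
      refine ih _ _ fun s hs => ?_
      have h1 := h (Function.update s j c) fun i => by
        rcases eq_or_ne i j with rfl | hij
        · simpa using hc
        · simpa [hij] using hs i
      have h2 : ∀ {E : Type _} [AddCommGroup E] [Module ℂ E] (z : ι → E),
          ∑ i ∈ F, Function.update s j c i • z i = ∑ i ∈ F, s i • z i := fun z =>
        Finset.sum_congr rfl fun i hi => by
          rw [Function.update_of_ne (ne_of_mem_of_not_mem hi hj)]
      rw [Finset.sum_insert hj, Finset.sum_insert hj, Function.update_self] at h1
      have h3 : ∑ i ∈ F, Function.update s j c i • v i = ∑ i ∈ F, s i • v i :=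
        Finset.sum_congr rfl fun i hi => by
          rw [Function.update_of_ne (ne_of_mem_of_not_mem hi hj)]
      rwa [h2 u, h3, ← add_assoc, ← add_assoc] at h1
    have e : β x y + ∑ i ∈ insert j F, β (u i) (v i) = (2⁻¹ : ℂ) •
        ((β (x + (1 : ℂ) • u j) (y + (1 : ℂ) • v j) + ∑ i ∈ F, β (u i) (v i)) +
          (β (x + (-1 : ℂ) • u j) (y + (-1 : ℂ) • v j) + ∑ i ∈ F, β (u i) (v i))) := by
      rw [Finset.sum_insert hj]
      simp only [map_add, map_smul, add_apply, smul_apply]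
      module
    rw [e, norm_smul]
    have h1 := norm_add_le_of_le (key 1 (.inl rfl)) (key (-1) (.inr rfl))
    have h2 : ‖(2⁻¹ : ℂ)‖ = 2⁻¹ := by simp
    rw [h2]
    linarith

/-- If all signed sums of the `u i` and of the `v i` are bounded, so is the sum of `β (u i) (v i)`,
with a bound independent of the number of summands. -/
theorem norm_sum_le_of_signed_sums {ι : Type*} (β : X →L[ℂ] Y →L[ℂ] Z) (u : ι → X) (v : ι → Y)
    (F : Finset ι) {p q : ℝ}
    (hu : ∀ s : ι → ℂ, (∀ i, s i = 1 ∨ s i = -1) → ‖∑ i ∈ F, s i • u i‖ ≤ p)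
    (hv : ∀ s : ι → ℂ, (∀ i, s i = 1 ∨ s i = -1) → ‖∑ i ∈ F, s i • v i‖ ≤ q) :
    ‖∑ i ∈ F, β (u i) (v i)‖ ≤ ‖β‖ * p * q := by
  have h := norm_add_sum_le_of_signed_sums β u v (‖β‖ * p * q) F 0 0 fun s hs => by
    rw [zero_add, zero_add]
    have hp : 0 ≤ p := (norm_nonneg _).trans (hu s hs)
    exact (β.le_opNorm₂ _ _).trans (by gcongr; exacts [hu s hs, hv s hs])
  simpa using h

end SignedSums

/-! ### Projectivity from an approximate diagonal. -/

section ApproximateDiagonal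

variable {R : Type w} [NonUnitalNormedRing R] [NormedSpace ℂ R]
  [IsScalarTower ℂ R R] [SMulCommClass ℂ R R]

/-- A criterion for left projectivity: the formal sum `∑ E i ⊗ E i` defines a right inverse of the
product map. -/
theorem isLeftProjective_of_signed_sums {ι : Type*} (E : ι → R) (N : ℝ)
    (hN : ∀ (F : Finset ι) (s : ι → ℂ), (∀ i, s i = 1 ∨ s i = -1) → ‖∑ i ∈ F, s i • E i‖ ≤ N)
    (htail : ∀ (a : R), ∀ δ > 0, ∃ F₀ : Finset ι, ∀ F : Finset ι, Disjoint F F₀ →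
      ∀ s : ι → ℂ, (∀ i, s i = 1 ∨ s i = -1) → ‖∑ i ∈ F, s i • (a * E i)‖ ≤ δ)
    (hsum : ∀ a b, HasSum (fun i => a * E i * E i) b → b = a) : IsLeftProjective R := by
  intro Y _ _ _ mY φ hφ ⟨σ, hσ⟩
  have hN0 : 0 ≤ N := (norm_nonneg _).trans (hN ∅ (fun _ => 1) fun _ => .inl rfl)
  have hσN : ∀ (F : Finset ι) (s : ι → ℂ), (∀ i, s i = 1 ∨ s i = -1) →
      ‖∑ i ∈ F, s i • σ (E i)‖ ≤ ‖σ‖ * N := fun F s hs => by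
    simp_rw [← map_smul, ← map_sum]
    exact (σ.le_opNorm _).trans (by gcongr; exact hN F s hs)
  let M : ℝ := ‖mY.act‖ * (‖σ‖ * N)
  have hM : 0 ≤ M := by positivity
  -- The series need not converge absolutely; the sign estimate bounds each finite block away from
  -- `F₀` by a small tail of `a * E i` times a bounded sum of `σ (E i)`.
  have hsummable : ∀ a, Summable fun i => mY.act (a * E i) (σ (E i)) := fun a => by
    rw [summable_iff_vanishing_norm]
    intro ε hε
    obtain ⟨F₀, hF₀⟩ := htail a (ε / (M + 1)) (by positivity)
    refine ⟨F₀, fun F hF => ?_⟩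
    calc _ ≤ ‖mY.act‖ * (ε / (M + 1)) * (‖σ‖ * N) :=
          norm_sum_le_of_signed_sums mY.act _ _ F (hF₀ F hF) (hσN F)
      _ = ε * (M / (M + 1)) := by simp only [M]; ring
      _ < ε * 1 := by
        gcongr
        rw [div_lt_one (by positivity)]
        linarith
      _ = ε := mul_one ε
  have hbound : ∀ a, ‖∑' i, mY.act (a * E i) (σ (E i))‖ ≤
      ‖mY.act‖ * N * (‖σ‖ * N) * ‖a‖ := fun a => by
    refine le_of_tendsto (hsummable a).hasSum.norm (Eventually.of_forall fun F => ?_)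
    have h1 := norm_sum_le_of_signed_sums mY.act (fun i => a * E i) (fun i => σ (E i)) F
      (p := ‖a‖ * N) (fun s hs => by
        simp_rw [← mul_smul_comm, ← Finset.mul_sum]
        exact (norm_mul_le _ _).trans (by gcongr; exact hN F s hs)) (hσN F)
    linarith
  let ψ : R →L[ℂ] Y := LinearMap.mkContinuous
    { toFun := fun a => ∑' i, mY.act (a * E i) (σ (E i))
      map_add' := fun a b => by
        rw [← (hsummable a).tsum_add (hsummable b)]
        simp [add_mul]
      map_smul' := fun c a => by
        rw [RingHom.id_apply, ← (hsummable a).tsum_const_smul]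
        simp [smul_mul_assoc] } (‖mY.act‖ * N * (‖σ‖ * N)) fun a => by simpa using hbound a
  have hψ : ∀ a, HasSum (fun i => mY.act (a * E i) (σ (E i))) (ψ a) := fun a => (hsummable a).hasSum
  refine ⟨ψ, fun a b => ?_, fun a => hsum a _ ?_⟩
  · refine (hψ (a * b)).unique ?_
    have h := (mY.act a).hasSum (hψ b)
    simpa only [← mY.mul_act, ← mul_assoc] using h
  · have h := φ.hasSum (hψ a)
    simp only [hφ, hσ] at h
    exact h

end ApproximateDiagonal

/-! ### Sections, units and restrictions of a field. -/

section FieldSections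

variable {Ω : Type u} [TopologicalSpace Ω] {A : Ω → Type v}
  [∀ t, NonUnitalNormedRing (A t)] [∀ t, NormedSpace ℂ (A t)]

namespace ContinuousField

/-- A family of units of the fibres of a locally trivial field is a continuous vector field. -/
theorem unit_mem (U : ContinuousField Ω A) (hU : U.IsLocallyTrivial) {e : ∀ t, A t}
    (he : ∀ t (a : A t), e t * a = a ∧ a * e t = a) : e ∈ U.Θ := by
  refine U.mem_of_locally_approx e fun t ε hε => ?_
  obtain ⟨V, hV, htV, B, _, _, _, _, _, ⟨Φ⟩⟩ := hU t
  -- Both are two-sided identities of the same algebra `B`, so the unit field is constant in a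
  -- trivialisation.
  have hconst : ∀ r s : V, Φ.toFun r (e r) = Φ.toFun s (e s) := fun r s => by
    have h1 : Φ.toFun r (e r) * Φ.toFun s (e s) = Φ.toFun r (e r) := by
      obtain ⟨a, ha⟩ := (Φ.toFun s).surjective (Φ.toFun r (e r))
      rw [← ha, ← Φ.map_mul, (he s a).2]
    have h2 : Φ.toFun r (e r) * Φ.toFun s (e s) = Φ.toFun s (e s) := by
      obtain ⟨a, ha⟩ := (Φ.toFun r).surjective (Φ.toFun s (e s))
      rw [← ha, ← Φ.map_mul, (he r a).1]
    rw [← h1, h2]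
  have hmem : (fun r : V => e r) ∈ (U.restrict V).Θ := by
    rw [Φ.mem_iff]
    have : (fun r : V => Φ.toFun r (e r)) = fun _ => Φ.toFun ⟨t, htV⟩ (e t) :=
      funext fun r => hconst r ⟨t, htV⟩
    rw [this]
    exact continuous_const
  obtain ⟨x', hx', h⟩ := hmem ⟨t, htV⟩ ε hε
  refine ⟨x', hx', ?_⟩
  rwa [← hV.isOpenEmbedding_subtypeVal.map_nhds_eq ⟨t, htV⟩, eventually_map]

/-- Continuous vector fields may be multiplied by continuous scalar functions. -/
theorem smul_function_mem (U : ContinuousField Ω A) {x : ∀ t, A t} (hx : x ∈ U.Θ) {f : Ω → ℂ}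
    (hf : Continuous f) : (fun t => f t • x t) ∈ U.Θ := by
  refine U.mem_of_locally_approx _ fun t ε hε => ⟨f t • x, SMulMemClass.smul_mem _ hx, ?_⟩
  have h : Tendsto (fun s => ‖f s - f t‖ * ‖x s‖) (𝓝 t) (𝓝 0) := by
    have := ((hf.sub continuous_const).norm.mul (U.continuous_norm x hx)).tendsto (x := t)
      (f := fun s => ‖f s - f t‖ * ‖x s‖)
    simpa using this
  filter_upwards [h.eventually_le_const hε] with s hs
  rwa [Pi.smul_apply, ← sub_smul, norm_smul]

/-- The element of the section algebra defined by a continuous vector field that vanishes at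
infinity. -/
def mkSection (U : ContinuousField Ω A) (x : ∀ t, A t) (hx : x ∈ U.Θ)
    (h0 : Tendsto (fun t => ‖x t‖) (cocompact Ω) (𝓝 0)) : U.sectionAlgebra :=
  ⟨⟨x, U.memℓp_of_tendsto hx h0⟩, hx, h0⟩

/-- The multiple of a continuous vector field by a compactly supported scalar function. -/
noncomputable def cutoff (U : ContinuousField Ω A) {x : ∀ t, A t} (hx : x ∈ U.Θ) (f : Ω → ℝ)
    (hf : Continuous f) (hc : HasCompactSupport f) : U.sectionAlgebra :=
  U.mkSection (fun t => (f t : ℂ) • x t)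
    (U.smul_function_mem hx (Complex.continuous_ofReal.comp hf)) (by
      refine tendsto_const_nhds.congr' (mem_of_superset hc.compl_mem_cocompact fun t ht => ?_)
      simp [image_eq_zero_of_notMem_tsupport ht])

theorem cutoff_apply (U : ContinuousField Ω A) {x : ∀ t, A t} (hx : x ∈ U.Θ) (f : Ω → ℝ)
    (hf : Continuous f) (hc : HasCompactSupport f) (t : Ω) :
    (U.cutoff hx f hf hc : lp A ∞) t = (f t : ℂ) • x t := rfl

/-- Evaluation of the sections at a point. -/
noncomputable def evalCLM (U : ContinuousField Ω A) (t : Ω) : U.sectionAlgebra →L[ℂ] A t :=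
  LinearMap.mkContinuous
    { toFun := fun a => (a : lp A ∞) t
      map_add' := fun _ _ => rfl
      map_smul' := fun _ _ => rfl } 1 fun a => by
    rw [one_mul]
    exact lp.norm_apply_le_norm ENNReal.top_ne_zero (a : lp A ∞) t

theorem evalCLM_apply (U : ContinuousField Ω A) (t : Ω) (a : U.sectionAlgebra) :
    U.evalCLM t a = (a : lp A ∞) t := rfl

theorem evalCLM_mul (U : ContinuousField Ω A) (t : Ω) (a b : U.sectionAlgebra) :
    U.evalCLM t (a * b) = U.evalCLM t a * U.evalCLM t b := rfl

theorem norm_evalCLM_le (U : ContinuousField Ω A) (t : Ω) (a : U.sectionAlgebra) :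
    ‖U.evalCLM t a‖ ≤ ‖a‖ := lp.norm_apply_le_norm ENNReal.top_ne_zero (a : lp A ∞) t

theorem norm_le_of_forall_evalCLM_le (U : ContinuousField Ω A) {a : U.sectionAlgebra} {c : ℝ}
    (hc : 0 ≤ c) (h : ∀ t, ‖U.evalCLM t a‖ ≤ c) : ‖a‖ ≤ c :=
  lp.norm_le_of_forall_le (f := (a : lp A ∞)) hc h

theorem section_ext (U : ContinuousField Ω A) {a b : U.sectionAlgebra}
    (h : ∀ t, U.evalCLM t a = U.evalCLM t b) : a = b :=
  Subtype.ext (Subtype.ext (funext h))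

/-- The pointwise bound `∑ k i ≤ 2` and the uniform bound on the units control the signed sums of `E
i = k i • e`. Tails of `a * E i` are small because only finitely many `k i` meet a compact set off
which `a` is small. -/
theorem isLeftProjective_of_paracompact [T2Space Ω] [LocallyCompactSpace Ω] [ParacompactSpace Ω]
    [∀ t, IsScalarTower ℂ (A t) (A t)] [∀ t, SMulCommClass ℂ (A t) (A t)]
    (U : ContinuousField Ω A) {e : ∀ t, A t} (he : ∀ t (a : A t), e t * a = a ∧ a * e t = a)
    (hmem : e ∈ U.Θ) {C : ℝ} (hC : ∀ t, ‖e t‖ ≤ C) : IsLeftProjective U.sectionAlgebra := by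
  obtain ⟨ι, k, hk, hkc, hkf, hk0, hk1, hk2⟩ := exists_square_partition (Ω := Ω)
  let E : ι → U.sectionAlgebra := fun i => U.cutoff hmem (k i) (hk i) (hkc i)
  have hE : ∀ i t (a : A t), a * U.evalCLM t (E i) = (k i t : ℂ) • a := fun i t a => by
    rw [evalCLM_apply, cutoff_apply, mul_smul_comm, (he t a).2]
  have hsigned : ∀ (F : Finset ι) (s : ι → ℂ), (∀ i, s i = 1 ∨ s i = -1) → ∀ t (a : A t),
      ‖∑ i ∈ F, s i • (k i t : ℂ) • a‖ ≤ (∑ i ∈ F, k i t) * ‖a‖ := fun F s hs t a => by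
    rw [Finset.sum_mul]
    refine norm_sum_le_of_le _ fun i _ => ?_
    have : ‖s i‖ = 1 := by rcases hs i with h | h <;> simp [h]
    rw [norm_smul, norm_smul, this, one_mul, Complex.norm_real, Real.norm_of_nonneg (hk0 i t)]
  -- The maximum with `0` covers an empty `Ω`, where `C` may be negative.
  have hC' : ∀ t, ∀ F : Finset ι, (∑ i ∈ F, k i t) * ‖e t‖ ≤ 2 * max C 0 := fun t F => by
    gcongr
    exacts [hk2 t F, (hC t).trans (le_max_left _ _)]
  refine isLeftProjective_of_signed_sums E (2 * max C 0) (fun F s hs => ?_) (fun a δ hδ => ?_)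
    fun a b hb => U.section_ext fun t => ?_
  · refine U.norm_le_of_forall_evalCLM_le (by positivity) fun t => ?_
    simp only [map_sum, map_smul]
    exact (hsigned F s hs t (e t)).trans (hC' t F)
  · have h1 := (a.2.2).eventually_lt_const (half_pos hδ)
    obtain ⟨K, hK, hKa⟩ := mem_cocompact.1 h1
    refine ⟨(hkf K hK).toFinset, fun F hF s hs => ?_⟩
    refine U.norm_le_of_forall_evalCLM_le hδ.le fun t => ?_
    simp only [map_sum, map_smul, evalCLM_mul, hE]
    refine (hsigned F s hs t _).trans ?_
    by_cases ht : t ∈ K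
    · have : ∑ i ∈ F, k i t = 0 := Finset.sum_eq_zero fun i hi => by
        by_contra h
        exact Finset.disjoint_left.1 hF hi ((hkf K hK).mem_toFinset.2 ⟨t, ht, h⟩)
      rw [this, zero_mul]
      exact hδ.le
    · calc _ ≤ 2 * (δ / 2) := by
            gcongr
            exacts [hk2 t F, (hKa ht).le]
        _ = δ := by ring
  · have h1 := (U.evalCLM t).hasSum hb
    simp only [evalCLM_mul, hE] at h1
    have h2 : HasSum (fun i => ((k i t ^ 2 : ℝ) : ℂ)) ((1 : ℝ) : ℂ) :=
      Complex.ofRealCLM.hasSum (hk1 t)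
    have h3 := h2.smul_const (U.evalCLM t a)
    rw [Complex.ofReal_one, one_smul] at h3
    refine HasSum.unique ?_ h3
    convert h1 using 2 with i
    rw [smul_smul, ← Complex.ofReal_mul, pow_two]

/-- A part of a subspace that lies over a trivialising set is trivialising for the restricted
field. -/
theorem isTrivial_restrict_restrict (U : ContinuousField Ω A) {V W : Set Ω}
    (hV : (U.restrict V).IsTrivial) {O : Set W} (hO : ∀ p ∈ O, (p : Ω) ∈ V) :
    ((U.restrict W).restrict O).IsTrivial := by
  obtain ⟨B, _, _, i1, i2, i3, ⟨Φ⟩⟩ := hV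
  let j : O → V := fun p => ⟨p.1.1, hO p.1 p.2⟩
  have hj : Continuous j := by fun_prop
  refine ⟨B, _, _, i1, i2, i3, ⟨⟨fun p => Φ.toFun (j p), fun p => Φ.map_mul (j p), fun x => ?_⟩⟩⟩
  constructor
  · intro hx
    -- Unfolding both restrictions approximates `x` by a global field `z`, whose image in the
    -- trivialisation is continuous.
    refine (const O B).mem_of_locally_approx _ fun p ε hε => ?_
    obtain ⟨y, hy, h1⟩ := hx p (ε / 2) (half_pos hε)
    obtain ⟨z, hz, h2⟩ := hy p (ε / 2) (half_pos hε)
    have hz' : (fun r : V => z r) ∈ (U.restrict V).Θ := fun r δ hδ =>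
      ⟨z, hz, Eventually.of_forall fun s => by simp [hδ.le]⟩
    have hz'' : Continuous fun r : V => Φ.toFun r (z r) := (Φ.mem_iff _).1 hz'
    refine ⟨fun q => Φ.toFun (j q) (z q.1), hz''.comp hj, ?_⟩
    filter_upwards [h1, continuous_subtype_val.continuousAt.eventually h2] with q hq1 hq2
    rw [← map_sub, LinearIsometryEquiv.norm_map]
    calc ‖x q - z q.1‖ ≤ ‖x q - y q‖ + ‖y q - z q.1‖ := norm_sub_le_norm_sub_add_norm_sub _ _ _
      _ ≤ ε / 2 + ε / 2 := add_le_add hq1 hq2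
      _ = ε := add_halves ε
  · intro hx p ε hε
    have hx : Continuous fun q : O => Φ.toFun (j q) (x q) := hx
    -- Conversely, `x` is near `p` close to the field that is constantly `b` in the trivialisation,
    -- and this one is approximated from `Θ`.
    let b : B := Φ.toFun (j p) (x p)
    have hb : (fun r : V => (Φ.toFun r).symm b) ∈ (U.restrict V).Θ := by
      rw [Φ.mem_iff]
      simp only [LinearIsometryEquiv.apply_symm_apply]
      exact continuous_const
    obtain ⟨z, hz, h1⟩ := hb (j p) (ε / 2) (half_pos hε)
    refine ⟨fun r => z r, fun r δ hδ => ⟨z, hz, Eventually.of_forall fun s => by simp [hδ.le]⟩, ?_⟩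
    have h2 := (Metric.tendsto_nhds.1 (hx.tendsto p)) (ε / 2) (half_pos hε)
    filter_upwards [hj.continuousAt.eventually h1, h2] with q hq1 hq2
    have h3 : ‖x q - (Φ.toFun (j q)).symm b‖ ≤ ε / 2 := by
      rw [← (Φ.toFun (j q)).norm_map, map_sub, LinearIsometryEquiv.apply_symm_apply, ← dist_eq_norm]
      exact hq2.le
    calc ‖x q - z q.1‖ ≤ ‖x q - (Φ.toFun (j q)).symm b‖ + ‖(Φ.toFun (j q)).symm b - z q.1‖ :=
          norm_sub_le_norm_sub_add_norm_sub _ _ _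
      _ ≤ ε / 2 + ε / 2 := add_le_add h3 hq1
      _ = ε := add_halves ε

/-- By regularity every point of a part has an open neighbourhood with closure in a trivialising
set; σ-compactness of the part leaves countably many of them. -/
theorem isDisjointUnionOfSigmaLocallyTrivial [T2Space Ω] [LocallyCompactSpace Ω]
    [ParacompactSpace Ω] (U : ContinuousField Ω A) (hU : U.IsLocallyTrivial) :
    U.IsDisjointUnionOfSigmaLocallyTrivial := by
  obtain ⟨P⟩ := ExhaustedPartition.nonempty_of_paracompact (Ω := Ω)
  refine ⟨range P.part, ?_, ?_, ?_, ?_⟩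
  · rintro _ ⟨x, rfl⟩
    exact P.isOpen_part x
  · rintro _ ⟨x, rfl⟩ _ ⟨y, rfl⟩ hne
    refine disjoint_left.2 fun z hz hz' => hne ?_
    exact P.part_eq (P.rel_of_mem_parts hz hz')
  · exact eq_univ_of_forall fun x => ⟨_, ⟨x, rfl⟩, P.mem_part_self x⟩
  · rintro _ ⟨x, rfl⟩
    have := P.sigmaCompactSpace_part x
    have := (P.isOpen_part x).locallyCompactSpace
    choose V hVo hV hVt using fun y : P.part x => hU y
    let O : P.part x → Set (P.part x) := fun y => Subtype.val ⁻¹' V y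
    have hO : ∀ y, IsOpen (O y) := fun y => (hVo y).preimage continuous_subtype_val
    have hnhds : ∀ y, ∃ S : Set (P.part x), IsOpen S ∧ y ∈ S ∧ closure S ⊆ O y := fun y => by
      obtain ⟨S, hS, hcS⟩ := exists_mem_nhds_isClosed_subset ((hO y).mem_nhds (hV y))
      exact ⟨interior S, isOpen_interior, mem_interior_iff_mem_nhds.2 hS,
        (closure_minimal interior_subset hcS.1).trans hcS.2⟩
    choose S hSo hS hSO using hnhds
    obtain ⟨T, hT, hTS⟩ := countable_cover_nhds_of_sigmaCompact fun y => (hSo y).mem_nhds (hS y)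
    refine ⟨range O, ?_, ?_, S '' T, hT.image S, ?_, ?_⟩
    · rintro _ ⟨y, rfl⟩
      exact ⟨hO y, U.isTrivial_restrict_restrict (hVt y) fun p hp => hp⟩
    · exact eq_univ_of_forall fun y => ⟨O y, ⟨y, rfl⟩, hV y⟩
    · rintro _ ⟨y, -, rfl⟩
      exact ⟨hSo y, O y, ⟨y, rfl⟩, hSO y⟩
    · rw [sUnion_image]
      exact hTS

end ContinuousField

end FieldSections

/-! ### Closed subspaces defined by limits. -/

section VanishingSubmodule

variable {E : Type*} [NormedAddCommGroup E] [NormedSpace ℂ E] {α : Type*} {Z : α → Type*}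
  [∀ i, NormedAddCommGroup (Z i)] [∀ i, NormedSpace ℂ (Z i)]

/-- The vectors on which a family of linear maps tends to zero along a filter. -/
def vanishingSubmodule (l : Filter α) (G : ∀ i, E →ₗ[ℂ] Z i) : Submodule ℂ E where
  carrier := {x | Tendsto (fun i => ‖G i x‖) l (𝓝 0)}
  add_mem' := fun {x y} hx hy => by
    refine squeeze_zero (fun _ => norm_nonneg _) (fun i => ?_) (by simpa using hx.add hy)
    rw [map_add]
    exact norm_add_le _ _
  zero_mem' := by simpa using tendsto_const_nhds
  smul_mem' := fun c x hx => by
    have : Tendsto (fun i => ‖c‖ * ‖G i x‖) l (𝓝 0) := by simpa using hx.const_mul ‖c‖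
    simpa [norm_smul] using this

theorem isClosed_vanishingSubmodule (l : Filter α) (G : ∀ i, E →ₗ[ℂ] Z i) {C : ℝ} (hC : 0 ≤ C)
    (hG : ∀ i x, ‖G i x‖ ≤ C * ‖x‖) : IsClosed (vanishingSubmodule l G : Set E) := by
  refine isClosed_of_closure_subset fun x hx => ?_
  rw [Metric.mem_closure_iff] at hx
  refine Metric.tendsto_nhds.2 fun ε hε => ?_
  obtain ⟨y, hy, hxy⟩ := hx (ε / (2 * (C + 1))) (by positivity)
  filter_upwards [Metric.tendsto_nhds.1 hy (ε / 2) (half_pos hε)] with i hi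
  simp only [dist_zero_right, norm_norm] at hi ⊢
  have h1 : ‖G i (x - y)‖ ≤ ε / 2 := by
    calc ‖G i (x - y)‖ ≤ C * ‖x - y‖ := hG i _
      _ ≤ (C + 1) * (ε / (2 * (C + 1))) := by
        gcongr
        · linarith
        · rw [← dist_eq_norm]; exact hxy.le
      _ = ε / 2 := by field_simp
  calc ‖G i x‖ = ‖G i (x - y) + G i y‖ := by rw [← map_add, sub_add_cancel]
    _ ≤ ‖G i (x - y)‖ + ‖G i y‖ := norm_add_le _ _
    _ < ε := by linarith

end VanishingSubmodule

/-! ### The test module of families indexed by fibre isometries. -/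

section TransportModule

variable {Ω : Type u} [TopologicalSpace Ω] {A : Ω → Type v}
  [∀ t, NonUnitalNormedRing (A t)] [∀ t, NormedSpace ℂ (A t)]

namespace ContinuousField

/-- Isometric isomorphisms of the nearby fibres onto the fibre at `s`, coming from a local
trivialisation. -/
structure LocalTransport (U : ContinuousField Ω A) (s : Ω) where
  /-- The neighbourhood of `s`. -/
  V : Set Ω
  isOpen : IsOpen V
  mem : s ∈ V
  /-- The isomorphisms. -/
  T : ∀ t : V, A t ≃ₗᵢ[ℂ] A s
  map_mul : ∀ t a b, T t (a * b) = T t a * T t b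
  T_self : T ⟨s, mem⟩ = LinearIsometryEquiv.refl ℂ (A s)
  continuous : ∀ x ∈ U.Θ, Continuous fun t : V => T t (x t)

/-- Pass to `B` at `t` and return at `s`; this normalises the transport to the identity at `s`. -/
theorem nonempty_localTransport (U : ContinuousField Ω A) (hU : U.IsLocallyTrivial) (s : Ω) :
    Nonempty (U.LocalTransport s) := by
  obtain ⟨V, hV, hs, B, _, _, _, _, _, ⟨Φ⟩⟩ := hU s
  refine ⟨⟨V, hV, hs, fun t => (Φ.toFun t).trans (Φ.toFun ⟨s, hs⟩).symm, fun t a b => ?_, ?_,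
    fun x hx => ?_⟩⟩
  · apply (Φ.toFun ⟨s, hs⟩).injective
    simp [Φ.map_mul]
  · ext a
    simp
  · have hx' : (fun r : V => x r) ∈ (U.restrict V).Θ := fun r δ hδ =>
      ⟨x, hx, Eventually.of_forall fun s => by simp [hδ.le]⟩
    have hc : Continuous fun r : V => Φ.toFun r (x r) := (Φ.mem_iff _).1 hx'
    exact (Φ.toFun ⟨s, hs⟩).symm.continuous.comp hc

/-- The isometric linear isomorphisms from a fibre `A t` onto a fibre `A s`, with `i.1 = (s, t)`. -/
abbrev FibreIsometry (A : Ω → Type v) [∀ t, NonUnitalNormedRing (A t)]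
    [∀ t, NormedSpace ℂ (A t)] : Type (max u v) := Σ p : Ω × Ω, A p.2 ≃ₗᵢ[ℂ] A p.1

/-- The bounded families `F` indexed by the isometries `T : A t ≃ A s`, with values in `A s`. -/
abbrev FibreFamily (A : Ω → Type v) [∀ t, NonUnitalNormedRing (A t)]
    [∀ t, NormedSpace ℂ (A t)] : Type (max u v) := lp (fun i : FibreIsometry A => A i.1.1) ∞

/-- The identity of `A s` as an index. -/
abbrev FibreIsometry.diag (A : Ω → Type v) [∀ t, NonUnitalNormedRing (A t)]
    [∀ t, NormedSpace ℂ (A t)] (s : Ω) : FibreIsometry A :=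
  ⟨(s, s), LinearIsometryEquiv.refl ℂ (A s)⟩

/-- The coordinates of a bounded family. -/
def FibreFamily.coord (i : FibreIsometry A) : FibreFamily A →ₗ[ℂ] A i.1.1 where
  toFun F := F i
  map_add' _ _ := rfl
  map_smul' _ _ := rfl

theorem FibreFamily.norm_coord_le (i : FibreIsometry A) (F : FibreFamily A) : ‖coord i F‖ ≤ ‖F‖ :=
  lp.norm_apply_le_norm ENNReal.top_ne_zero F i

variable {U : ContinuousField Ω A}

namespace LocalTransport

/-- Transport from a nearby fibre, as an index. -/
abbrev toIdx {s : Ω} (L : U.LocalTransport s) (t : L.V) : FibreIsometry A := ⟨(s, t), L.T t⟩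

/-- Transport to a nearby fibre, as an index. -/
abbrev ofIdx {s : Ω} (L : U.LocalTransport s) (t : L.V) : FibreIsometry A := ⟨(t, s), (L.T t).symm⟩

/-- The filter of neighbourhoods of `s` in the domain of a local transport. -/
abbrev nhds {s : Ω} (L : U.LocalTransport s) : Filter L.V := 𝓝 ⟨s, L.mem⟩

open FibreFamily in
/-- The families in `FibreFamily A` which are continuous at the diagonal and vanish at infinity
in the second variable. -/
noncomputable def families (L : ∀ s, U.LocalTransport s) : Submodule ℂ (FibreFamily A) :=
  U.Θ.toSubmodule.comap (LinearMap.pi fun s => coord (.diag A s)) ⊓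
    (vanishingSubmodule (comap (fun i : FibreIsometry A => i.1.2) (cocompact Ω)) coord ⊓
    -- The diagonal is approached twice, by moving the second variable and by moving the first: the
    -- relation built from the kernel must hold near the diagonal in both orders.
    ⨅ s, (vanishingSubmodule (L s).nhds (fun t => coord ((L s).toIdx t) - coord (.diag A s)) ⊓
      vanishingSubmodule (L s).nhds (fun t =>
        ((L s).T t).toLinearEquiv.toLinearMap ∘ₗ coord ((L s).ofIdx t) - coord (.diag A s))))

open FibreFamily

variable (L : ∀ s, U.LocalTransport s)

theorem mem_families_iff {F : FibreFamily A} : F ∈ families L ↔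
    (fun s => F (.diag A s)) ∈ U.Θ ∧
    Tendsto (fun i => ‖F i‖) (comap (fun i : FibreIsometry A => i.1.2) (cocompact Ω)) (𝓝 0) ∧
    ∀ s, Tendsto (fun t => F ((L s).toIdx t)) (L s).nhds (𝓝 (F (.diag A s))) ∧
      Tendsto (fun t => (L s).T t (F ((L s).ofIdx t))) (L s).nhds (𝓝 (F (.diag A s))) := by
  simp only [families, Submodule.mem_inf, Submodule.mem_iInf]
  refine and_congr Iff.rfl (and_congr Iff.rfl (forall_congr' fun s => and_congr ?_ ?_))
  · rw [tendsto_iff_norm_sub_tendsto_zero]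
    exact Iff.rfl
  · rw [tendsto_iff_norm_sub_tendsto_zero]
    exact Iff.rfl

/-- Projectivity is tested on complete modules only. All the conditions survive uniform limits,
since coordinates are contractive and transports isometric. -/
theorem isClosed_families : IsClosed (families L : Set (FibreFamily A)) := by
  have h1 : IsClosed {F : FibreFamily A | (fun s => coord (.diag A s) F) ∈ U.Θ} := by
    refine isClosed_of_closure_subset fun F hF => U.mem_of_locally_approx _ fun t ε hε => ?_
    obtain ⟨G, hG, hd⟩ := Metric.mem_closure_iff.1 hF ε hε
    refine ⟨_, hG, Eventually.of_forall fun s => ?_⟩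
    rw [← map_sub]
    exact (norm_coord_le _ _).trans (by rw [← dist_eq_norm]; exact hd.le)
  simp only [families, Submodule.coe_inf, Submodule.coe_iInf]
  refine IsClosed.inter h1 ((isClosed_vanishingSubmodule _ _ zero_le_one fun i F => ?_).inter ?_)
  · rw [one_mul]
    exact norm_coord_le _ _
  · refine isClosed_iInter fun s => (isClosed_vanishingSubmodule _ _ zero_le_two fun t F => ?_).inter
      (isClosed_vanishingSubmodule _ _ zero_le_two fun t F => ?_)
    · refine (norm_sub_le _ _).trans ?_
      rw [two_mul]
      exact add_le_add (norm_coord_le _ _) (norm_coord_le _ _)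
    · refine (norm_sub_le _ _).trans ?_
      rw [two_mul]
      refine add_le_add ?_ (norm_coord_le _ _)
      exact (((L s).T t).norm_map _).trans_le (norm_coord_le _ _)

/-- A section as a family depending on the first variable only. -/
noncomputable def lift (a : U.sectionAlgebra) : FibreFamily A :=
  ⟨fun i => U.evalCLM i.1.1 a, memℓp_infty ⟨‖a‖, by
    rintro _ ⟨i, rfl⟩
    exact U.norm_evalCLM_le _ a⟩⟩

theorem norm_lift_le (a : U.sectionAlgebra) : ‖lift a‖ ≤ ‖a‖ :=
  lp.norm_le_of_forall_le (norm_nonneg a) fun i => U.norm_evalCLM_le i.1.1 a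

theorem lift_mul_mem (a : U.sectionAlgebra) {F : FibreFamily A} (hF : F ∈ families L) :
    lift a * F ∈ families L := by
  rw [mem_families_iff] at hF ⊢
  obtain ⟨h1, h2, h3⟩ := hF
  refine ⟨U.Θ.mul_mem a.2.1 h1, ?_, fun s => ⟨?_, ?_⟩⟩
  · refine squeeze_zero (fun _ => norm_nonneg _) (fun i => (?_ : _ ≤ ‖a‖ * ‖F i‖))
      (by simpa using h2.const_mul ‖a‖)
    exact (norm_mul_le _ _).trans
      (mul_le_mul_of_nonneg_right (U.norm_evalCLM_le _ a) (norm_nonneg _))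
  · exact (h3 s).1.const_mul (U.evalCLM s a)
  -- Here the acting element moves with `t`; multiplicativity of the transport lets the two limits
  -- be multiplied in `A s`.
  · have h4 : Tendsto (fun t : (L s).V => (L s).T t (U.evalCLM t a)) (L s).nhds
        (𝓝 (U.evalCLM s a)) := by
      have := ((L s).continuous _ a.2.1).tendsto ⟨s, (L s).mem⟩
      rw [(L s).T_self] at this
      exact this
    refine (h4.mul (h3 s).2).congr fun t => ?_
    exact ((L s).map_mul t _ _).symm

/-- The left Banach module of families, with pointwise multiplication in the first variable. -/
noncomputable def familyModule [∀ t, IsScalarTower ℂ (A t) (A t)]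
    [∀ t, SMulCommClass ℂ (A t) (A t)] : LeftBanachModule U.sectionAlgebra (families L) where
  act := LinearMap.mkContinuous₂
    (LinearMap.mk₂ ℂ (fun a F => (⟨lift a * F, lift_mul_mem L a F.2⟩ : families L))
      (fun a b F => Subtype.ext (add_mul (lift a) (lift b) (F : FibreFamily A)))
      (fun c a F => Subtype.ext (smul_mul_assoc c (lift a) (F : FibreFamily A)))
      (fun a F G => Subtype.ext (mul_add (lift a) (F : FibreFamily A) G))
      (fun c a F => Subtype.ext (mul_smul_comm c (lift a) (F : FibreFamily A))))
    1 fun a F => by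
      rw [one_mul]
      exact (norm_mul_le (lift a) (F : FibreFamily A)).trans
        (mul_le_mul_of_nonneg_right (norm_lift_le a) (norm_nonneg _))
  mul_act a b F := Subtype.ext (mul_assoc (lift a) (lift b) (F : FibreFamily A))

theorem familyModule_act_apply [∀ t, IsScalarTower ℂ (A t) (A t)]
    [∀ t, SMulCommClass ℂ (A t) (A t)] (a : U.sectionAlgebra) (F : families L) (i : FibreIsometry A) :
    ((familyModule L).act a F : FibreFamily A) i = U.evalCLM i.1.1 a * (F : FibreFamily A) i := rfl

/-- Restriction of a family to the diagonal. -/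
noncomputable def diagonal : families L →L[ℂ] U.sectionAlgebra := LinearMap.mkContinuous
  { toFun := fun F => U.mkSection (fun s => (F : FibreFamily A) (.diag A s)) ((mem_families_iff L).1 F.2).1
      (((mem_families_iff L).1 F.2).2.1.comp (tendsto_comap_iff.2 tendsto_id :
        Tendsto (FibreIsometry.diag A) (cocompact Ω) (comap (fun i => i.1.2) (cocompact Ω))))
    map_add' := fun _ _ => rfl
    map_smul' := fun _ _ => rfl } 1 fun F => by
  rw [one_mul]
  exact U.norm_le_of_forall_evalCLM_le (norm_nonneg _) fun s => norm_coord_le (.diag A s) _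

/-- A section as a family depending on the second variable only. -/
noncomputable def spread (a : U.sectionAlgebra) : FibreFamily A :=
  ⟨fun i => i.2 (U.evalCLM i.1.2 a), memℓp_infty ⟨‖a‖, by
    rintro _ ⟨i, rfl⟩
    exact (i.2.norm_map _).trans_le (U.norm_evalCLM_le _ a)⟩⟩

theorem norm_spread_le (a : U.sectionAlgebra) : ‖spread a‖ ≤ ‖a‖ :=
  lp.norm_le_of_forall_le (norm_nonneg a)
    fun i => (i.2.norm_map _).trans_le (U.norm_evalCLM_le i.1.2 a)

/-- The index is an isometry, so the norm is that of `a` at the second variable and vanishes at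
infinity there. If the first variable moves, the transported value is constant. -/
theorem spread_mem (a : U.sectionAlgebra) : spread a ∈ families L := by
  rw [mem_families_iff]
  refine ⟨a.2.1, ?_, fun s => ⟨?_, ?_⟩⟩
  · exact (a.2.2.comp tendsto_comap).congr fun i => (i.2.norm_map _).symm
  · have := ((L s).continuous _ a.2.1).tendsto ⟨s, (L s).mem⟩
    rw [(L s).T_self] at this
    exact this
  · refine tendsto_const_nhds.congr fun t => ?_
    exact (((L s).T t).apply_symm_apply (U.evalCLM s a)).symm

/-- The map `spread` as a bounded linear operator. -/
noncomputable def spreadCLM : U.sectionAlgebra →L[ℂ] families L := LinearMap.mkContinuous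
  (LinearMap.codRestrict (families L)
    { toFun := spread
      map_add' := fun _ _ => lp.ext (funext fun i => map_add i.2 _ _)
      map_smul' := fun c _ => lp.ext (funext fun i => map_smul i.2 c _) } (spread_mem L)) 1
  fun a => (norm_spread_le a).trans_eq (one_mul _).symm

theorem diagonal_spreadCLM (a : U.sectionAlgebra) : diagonal L (spreadCLM L a) = a :=
  U.section_ext fun _ => rfl

theorem diagonal_act [∀ t, IsScalarTower ℂ (A t) (A t)] [∀ t, SMulCommClass ℂ (A t) (A t)]
    (a : U.sectionAlgebra) (F : families L) :
    diagonal L ((familyModule L).act a F) = a * diagonal L F :=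
  U.section_ext fun _ => rfl

end LocalTransport

end ContinuousField

end TransportModule

/-! ### From a module splitting to paracompactness. -/

section Paracompactness

variable {Ω : Type u} [TopologicalSpace Ω] {A : Ω → Type v}
  [∀ t, NonUnitalNormedRing (A t)] [∀ t, NormedSpace ℂ (A t)]

namespace ContinuousField

open LocalTransport in
/-- If the section algebra of a locally trivial field of unital Banach algebras is left projective,
then the base space is paracompact. -/
theorem paracompactSpace_of_isLeftProjective [T2Space Ω] [LocallyCompactSpace Ω]
    [∀ t, IsScalarTower ℂ (A t) (A t)] [∀ t, SMulCommClass ℂ (A t) (A t)]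
    [∀ t, CompleteSpace (A t)] [∀ t, Nontrivial (A t)]
    (U : ContinuousField Ω A) (hU : U.IsLocallyTrivial)
    {e : ∀ t, A t} (he : ∀ t (a : A t), e t * a = a ∧ a * e t = a)
    (hproj : IsLeftProjective U.sectionAlgebra) : ParacompactSpace Ω := by
  have hmem : e ∈ U.Θ := U.unit_mem hU he
  have hnorm : ∀ t, 1 ≤ ‖e t‖ := fun t => by
    have h0 : e t ≠ 0 := fun h => by
      obtain ⟨a, ha⟩ := exists_ne (0 : A t)
      exact ha (by rw [← (he t a).1, h, zero_mul])
    have h1 : ‖e t‖ ≤ ‖e t‖ * ‖e t‖ := by simpa [(he t (e t)).1] using norm_mul_le (e t) (e t)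
    exact le_of_mul_le_mul_left (by simpa using h1) (norm_pos_iff.2 h0)
  let L : ∀ s, U.LocalTransport s := fun s => (U.nonempty_localTransport hU s).some
  have : CompleteSpace (families L) := (isClosed_families L).completeSpace_coe
  obtain ⟨ψ, hψ, hs⟩ := hproj (families L) (familyModule L) (diagonal L) (diagonal_act L)
    ⟨spreadCLM L, diagonal_spreadCLM L⟩
  have hcut : ∀ K : Set Ω, IsCompact K → ∃ f : Ω → ℝ, Continuous f ∧ HasCompactSupport f ∧
      EqOn f 1 K := fun K hK => by
    obtain ⟨f, hf, -, hc, -⟩ := exists_continuous_one_zero_of_isCompact hK isClosed_empty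
      (disjoint_empty K)
    exact ⟨f, f.continuous, hc, hf⟩
  -- The value `1` is needed on a whole neighbourhood, so that the cut-off of `s` also serves at
  -- nearby points.
  have hcut' : ∀ s : Ω, ∃ f : Ω → ℝ, Continuous f ∧ HasCompactSupport f ∧
      ∀ᶠ t in 𝓝 s, f t = 1 := fun s => by
    obtain ⟨K, hK, hs⟩ := exists_compact_mem_nhds s
    obtain ⟨f, hf, hc, h⟩ := hcut K hK
    exact ⟨f, hf, hc, mem_of_superset hs h⟩
  let Ψ : ∀ f : Ω → ℝ, Continuous f → HasCompactSupport f → FibreFamily A := fun f hf hc =>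
    ψ (U.cutoff hmem f hf hc)
  have hΨ : ∀ f hf hc, Ψ f hf hc ∈ families L := fun f hf hc =>
    (ψ (U.cutoff hmem f hf hc)).2
  have hdiag : ∀ f hf hc s, Ψ f hf hc (.diag A s) = (f s : ℂ) • e s := fun f hf hc s =>
    congr(U.evalCLM s $(hs (U.cutoff hmem f hf hc)))
  -- The cut-offs `f • e` and `g • e` commute, so the morphism property computes `ψ` of their
  -- product in two ways.
  have hcomm : ∀ f hf hc g hg hd (i : FibreIsometry A),
      (f i.1.1 : ℂ) • Ψ g hg hd i = (g i.1.1 : ℂ) • Ψ f hf hc i := by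
    have aux : ∀ f hf hc g hg hd (i : FibreIsometry A), (f i.1.1 : ℂ) • Ψ g hg hd i =
        (ψ (U.cutoff hmem f hf hc * U.cutoff hmem g hg hd) : FibreFamily A) i :=
      fun f hf hc g hg hd i => by
        have h1 := congr(($(hψ (U.cutoff hmem f hf hc) (U.cutoff hmem g hg hd)) : FibreFamily A) i)
        rw [familyModule_act_apply, evalCLM_apply, cutoff_apply, smul_mul_assoc, (he _ _).1] at h1
        exact h1.symm
    intro f hf hc g hg hd i
    have hswap : U.cutoff hmem f hf hc * U.cutoff hmem g hg hd =
        U.cutoff hmem g hg hd * U.cutoff hmem f hf hc := U.section_ext fun t => by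
      rw [evalCLM_mul, evalCLM_mul]
      simp only [evalCLM_apply, cutoff_apply, smul_mul_assoc, mul_smul_comm]
      rw [smul_comm]
    rw [aux f hf hc, aux g hg hd, hswap]
  -- Hence the value over a point does not depend on the cut-off, provided it is `1` there: all the
  -- `Ψ f` are pieces of one kernel.
  have hind : ∀ f hf hc g hg hd (i : FibreIsometry A), f i.1.1 = 1 → g i.1.1 = 1 →
      Ψ g hg hd i = Ψ f hf hc i := fun f hf hc g hg hd i h1 h2 => by
    simpa [h1, h2] using hcomm f hf hc g hg hd i
  choose h hh hhc hh1 using hcut'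
  have hself : ∀ s, h s s = 1 := fun s => (hh1 s).self_of_nhds
  have hdiag1 : ∀ s, Ψ (h s) (hh s) (hhc s) (.diag A s) = e s := fun s => by
    rw [hdiag, hself, Complex.ofReal_one, one_smul]
  -- No isometry between distant fibres is canonical, so some `T` is asked for. Any threshold in
  -- `(0, 1)` would do, as the diagonal value `e s` has norm at least `1`.
  let N : Ω → Ω → Prop := fun s t => ∃ T : A t ≃ₗᵢ[ℂ] A s,
    1 / 2 ≤ ‖Ψ (h s) (hh s) (hhc s) ⟨(s, t), T⟩‖
  have hlift : ∀ s (p : Ω → Prop), (∀ᶠ t : (L s).V in (L s).nhds, p t) → ∀ᶠ t in 𝓝 s, p t :=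
    fun s p hp => by
      rwa [← (L s).isOpen.isOpenEmbedding_subtypeVal.map_nhds_eq ⟨s, (L s).mem⟩, eventually_map]
  have hlarge : ∀ s {α : Type _} {l : Filter α} {x : α → A s}, Tendsto x l (𝓝 (e s)) →
      ∀ᶠ t in l, 1 / 2 ≤ ‖x t‖ := fun s _ _ _ hx =>
    (hx.norm.eventually_const_lt (by linarith [hnorm s] : 1 / 2 < ‖e s‖)).mono fun _ => le_of_lt
  refine (ExhaustedPartition.nonempty_of_relation (fun s t => N s t ∧ N t s)
    (fun _ _ h => ⟨h.2, h.1⟩) (fun s => ?_) fun K hK => ?_).elim fun P => P.paracompactSpace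
  · obtain ⟨-, -, h3⟩ := (mem_families_iff L).1 (hΨ (h s) (hh s) (hhc s))
    obtain ⟨h4, h5⟩ := h3 s
    rw [hdiag1] at h4 h5
    refine Eventually.and ?_ ?_
    · refine hlift s _ ((hlarge s h4).mono fun t ht => ⟨(L s).T t, ht⟩)
    · have h6 : ∀ᶠ t : (L s).V in (L s).nhds, h s t = 1 :=
        (continuous_subtype_val.tendsto (⟨s, (L s).mem⟩ : (L s).V)).eventually (hh1 s)
      refine hlift s _ ?_
      filter_upwards [hlarge s h5, h6] with t ht ht1
      -- The first variable is now `t`, where both `h s` and `h t` equal `1`, so one cut-off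
      -- replaces the other.
      refine ⟨((L s).T t).symm, ?_⟩
      rw [LinearIsometryEquiv.norm_map] at ht
      rwa [hind (h s) (hh s) (hhc s) (h t) (hh t) (hhc t) ((L s).ofIdx t) ht1 (hself t)]
  -- One cut-off serves all `s ∈ K`, and decay of `Ψ f` in the second variable is uniform in the
  -- first.
  · obtain ⟨f, hf, hc, hf1⟩ := hcut K hK
    obtain ⟨-, h2, -⟩ := (mem_families_iff L).1 (hΨ f hf hc)
    obtain ⟨S, hS, hSΨ⟩ := mem_comap.1 (h2.eventually_lt_const (by norm_num : (0 : ℝ) < 1 / 2))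
    obtain ⟨M, hM, hMS⟩ := mem_cocompact.1 hS
    refine ⟨M, hM, fun s hsK t hst => ?_⟩
    by_contra ht
    obtain ⟨T, hT⟩ := hst.1
    rw [hind f hf hc (h s) (hh s) (hhc s) ⟨(s, t), T⟩ (hf1 hsK) (hself s)] at hT
    exact not_lt.2 hT (hSΨ (hMS ht : (⟨(s, t), T⟩ : FibreIsometry A) ∈ _))

end ContinuousField

end Paracompactness

theorem theorem4p13 {Ω : Type u} [TopologicalSpace Ω] [T2Space Ω] [LocallyCompactSpace Ω]
    {A : Ω → Type v} [∀ t, NonUnitalNormedRing (A t)] [∀ t, NormedSpace ℂ (A t)]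
    [∀ t, IsScalarTower ℂ (A t) (A t)] [∀ t, SMulCommClass ℂ (A t) (A t)]
    [∀ t, CompleteSpace (A t)] [∀ t, Nontrivial (A t)]
    (U : ContinuousField Ω A) (hU : U.IsLocallyTrivial)
    (e : ∀ t, A t) (he : ∀ t (a : A t), e t * a = a ∧ a * e t = a)
    (C : ℝ) (hC : ∀ t, ‖e t‖ ≤ C) :
    List.TFAE [
      ParacompactSpace Ω,
      IsLeftProjective U.sectionAlgebra,
      IsLeftProjective U.sectionAlgebra ∧ U.IsDisjointUnionOfSigmaLocallyTrivial,
      H2VanishesOnRightAnnihilators U.sectionAlgebra] := by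
  have hmem : e ∈ U.Θ := U.unit_mem hU he
  tfae_have 1 → 3 := fun _ =>
    ⟨U.isLeftProjective_of_paracompact he hmem hC, U.isDisjointUnionOfSigmaLocallyTrivial hU⟩
  tfae_have 3 → 2 := fun h => h.1
  tfae_have 2 → 1 := U.paracompactSpace_of_isLeftProjective hU he
  tfae_have 2 ↔ 4 := isLeftProjective_iff_H2Vanishes
  tfae_finish
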